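/- **Model.** A $2\times2$ input-queued switch has four queues, numbered row by row: queues $1,2$ belong to the first input port and $3,4$ to the second; queues $1,3$ are destined to the first output port and $2,4$ to the second. A schedule is a vector $s\in\{0,1\}^4$ with $s_1+s_2\le1$, $s_3+s_4\le1$, $s_1+s_3\le1$, $s_2+s_4\le1$. In a time slot with queue lengths $q\in\mathbb Z_+^4$, a schedule $s$ maximizing $\langle q,s\rangle$ over all schedules is chosen (MaxWeight; ties are broken at random according to an arbitrary rule), then arrivals $a\in\mathbb Z_+^4$ occur, and the queue lengths become $q^+_i=q_i+a_i-s_i+u_i$, where $u_i=\max\{s_i-q_i-a_i,0\}$ is the unused service. Arrival vectors are i.i.d. over time, independent of the queue lengths and the schedule, and arrivals to different queues are independent. Fix $\nu\in\mathbb R^4$ with $\nu_i>0$ for all $i$ and $\nu_1+\nu_2=\nu_3+\nu_4=\nu_1+\nu_3=\nu_2+\nu_4=1$. For every $\epsilon\in(0,1)$ consider such a switch whose arrivals have mean vector $(1-\epsilon)\nu$ and are bounded by a constant $A_{\max}$ independent of $\epsilon$, and let $\overline q^{(\epsilon)}$ be distributed according to a steady-state (stationary) law of the Markov chain of queue lengths.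 Suppose that, for $i=1,\dots,4$, the variance of the number of arrivals to queue $i$ converges to $\sigma_{a_i}^2$ as $\epsilon\downarrow0$. **Polytope.** Let $\mathcal P$ be the set of all $(v,w)\in\mathbb R_+^3\times\mathbb R_+^8$ with $$v_1-\tfrac12(w_1+w_2-w_5-w_8)=\tfrac1{16}(9\sigma_{a_1}^2+\sigma_{a_2}^2+\sigma_{a_3}^2+\sigma_{a_4}^2),$$ $$v_2-\tfrac12(w_3-w_4+w_5)=\tfrac1{16}(\sigma_{a_1}^2+9\sigma_{a_2}^2+\sigma_{a_3}^2+\sigma_{a_4}^2),$$ $$v_3-\tfrac12(w_6-w_7+w_8)=\tfrac1{16}(\sigma_{a_1}^2+\sigma_{a_2}^2+9\sigma_{a_3}^2+\sigma_{a_4}^2),$$ $$v_1+v_2-\tfrac12(3w_1-w_2+3w_3+w_4+w_8)=\tfrac18(3\sigma_{a_1}^2+3\sigma_{a_2}^2-\sigma_{a_3}^2-\sigma_{a_4}^2),$$ $$v_1+v_3-\tfrac12(-w_1+3w_2+w_5+3w_6+w_7)=\tfrac18(3\sigma_{a_1}^2-\sigma_{a_2}^2+3\sigma_{a_3}^2-\sigma_{a_4}^2),$$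 $$v_2+v_3-\tfrac12(w_3+3w_4+w_5+w_6+3w_7+w_8)=\tfrac18(\sigma_{a_1}^2-3\sigma_{a_2}^2-3\sigma_{a_3}^2+\sigma_{a_4}^2),$$ $$-v_1+v_2+v_3\ge0,\qquad -w_1+w_7\ge0,\qquad -w_2+w_4\ge0.$$ For $\alpha\in\mathbb R^3$ put $\langle\alpha,q\rangle=\alpha_1q_1+\alpha_2q_2+\alpha_3q_3$ for $q\in\mathbb R^4$, and let $\underline f(\alpha)$ and $\overline f(\alpha)$ be the minimum and the maximum of $\langle\alpha,v\rangle$ over $(v,w)\in\mathcal P$. **Theorem.** For every $\alpha\in\mathbb R^3$: 1. The minimum $\underline f(\alpha)$ and the maximum $\overline f(\alpha)$ are attained, the means $\mathbb E[\overline q_i^{(\epsilon)}]$ are finite for every $\epsilon\in(0,1)$ and $i=1,\dots,4$, and $$\underline f(\alpha)\le\liminf_{\epsilon\downarrow0}\epsilon\,\mathbb E\langle\alpha,\overline q^{(\epsilon)}\rangle\le\limsup_{\epsilon\downarrow0}\epsilon\,\mathbb E\langle\alpha,\overline q^{(\epsilon)}\rangle\le\overline f(\alpha).$$ In particular, $\underline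 f(\alpha)\le\lim_{\epsilon\downarrow0}\epsilon\,\mathbb E\langle\alpha,\overline q^{(\epsilon)}\rangle\le\overline f(\alpha)$ whenever the limit exists. 2. Suppose that $\alpha_1x_1+\alpha_2x_2+\alpha_3x_3\ge0$ for all $x\in\mathbb R_+^4$ with $x_1+x_4=x_2+x_3$ (for instance, $\alpha\in\mathbb R_+^3$). If $\epsilon\langle\alpha,\overline q^{(\epsilon)}\rangle$ converges in distribution to a random variable $X$ as $\epsilon\downarrow0$ (or merely along a sequence, or any proper filter, of values $\epsilon\downarrow0$), then $\mathbb P(X\ge B)\le\overline f(\alpha)/B$ for every $B>0$. -/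

import Mathlib

open Filter Topology MeasureTheory ProbabilityTheory

noncomputable section

namespace InputQueuedSwitch

/-- Vectors of queue lengths, arrivals and services of the `2 × 2` switch.  The queues are
enumerated row by row: indices `0, 1` are the queues of the first input port, `2, 3` those of the
second one; `0, 2` are destined to the first output port and `1, 3` to the second one. -/
abbrev QVec : Type := Fin 4 → ℕ

/-- Feasible schedules: `0/1` vectors with at most one active queue in each row and column. -/
def IsSchedule (s : QVec) : Prop :=
  (∀ i, s i ≤ 1) ∧ s 0 + s 1 ≤ 1 ∧ s 2 + s 3 ≤ 1 ∧ s 0 + s 2 ≤ 1 ∧ s 1 + s 3 ≤ 1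

/-- Total queue length served by a schedule, i.e. the dot product `⟨q, s⟩`. -/
def weight (q s : QVec) : ℕ := ∑ i, q i * s i

/-- `s` is a feasible schedule of maximum weight when the queue lengths are `q`. -/
def IsMaxWeight (q s : QVec) : Prop :=
  IsSchedule s ∧ ∀ x, IsSchedule x → weight q x ≤ weight q s

/-- A (randomized) scheduling rule assigns to each vector of queue lengths the law of the schedule
that is used.  It is a MaxWeight rule if it only uses schedules of maximum weight; ties are broken
at random, with arbitrary probabilities. -/
def IsMaxWeightRule (rule : QVec → PMF QVec) : Prop :=
  ∀ q, ∀ s ∈ (rule q).support, IsMaxWeight q s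

/-- Unused service: the part of the potential service `s` exceeding the packets in line and the
arrivals. -/
def unused (q a s : QVec) : QVec := fun i => s i - min (s i) (q i + a i)

/-- Queue lengths at the end of the time slot: `q + a - s + u`, with `u` the unused service.
The subtraction never truncates, see `next_add`. -/
def next (q a s : QVec) : QVec := fun i => q i + a i + unused q a s i - s i

theorem next_add (q a s : QVec) (i : Fin 4) :
    next q a s i + s i = q i + a i + unused q a s i := by
  unfold next unused
  omega

theorem next_mul_unused (q a s : QVec) (i : Fin 4) :
    next q a s i * unused q a s i = 0 := by
  rw [mul_eq_zero]
  unfold next unused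
  omega

/-- Joint law of the arrivals of one time slot, independent across queues, where `A i` is the law
of the number of arrivals to queue `i`. -/
def arrivals (A : Fin 4 → PMF ℕ) : PMF QVec :=
  (A 0).bind fun a₀ => (A 1).bind fun a₁ => (A 2).bind fun a₂ => (A 3).bind fun a₃ =>
    PMF.pure ![a₀, a₁, a₂, a₃]

/-- One-step transition law of the Markov chain of queue lengths: the schedule is chosen given the
queue lengths, and the arrivals are independent of the queue lengths and of the schedule. -/
def step (A : Fin 4 → PMF ℕ) (rule : QVec → PMF QVec) (q : QVec) : PMF QVec :=
  (rule q).bind fun s => (arrivals A).bind fun a => PMF.pure (next q a s)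

/-- `π` is a steady-state (stationary) law of the Markov chain of queue lengths. -/
def IsSteadyState (A : Fin 4 → PMF ℕ) (rule : QVec → PMF QVec) (π : PMF QVec) : Prop :=
  π.bind (step A rule) = π

/-- Mean of a law on the natural numbers. -/
def arrivalMean (p : PMF ℕ) : ℝ := ∫ n, (n : ℝ) ∂p.toMeasure

/-- Variance of a law on the natural numbers. -/
def arrivalVar (p : PMF ℕ) : ℝ := Var[fun n : ℕ => (n : ℝ); p.toMeasure]

/-- Completely saturated rate vectors with positive entries: all row and column sums are `1`. -/
def IsSaturated (ν : Fin 4 → ℝ) : Prop :=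
  (∀ i, 0 < ν i) ∧ ν 0 + ν 1 = 1 ∧ ν 2 + ν 3 = 1 ∧ ν 0 + ν 2 = 1 ∧ ν 1 + ν 3 = 1

/-- A family of completely saturated `2 × 2` input-queued switches with independent arrivals that
operate under MaxWeight, in steady state, indexed by the heavy-traffic parameter `ε ∈ (0,1)`:
`A ε i` is the law of the arrivals to queue `i`, `rule ε` is the scheduling rule and `π ε` is the
law of the steady-state queue lengths. -/
structure IsHeavyTrafficFamily (ν : Fin 4 → ℝ) (Amax : ℕ) (A : ℝ → Fin 4 → PMF ℕ)
    (rule : ℝ → QVec → PMF QVec) (π : ℝ → PMF QVec) : Prop where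
  saturated : IsSaturated ν
  arrival_le : ∀ ε ∈ Set.Ioo (0 : ℝ) 1, ∀ i, ∀ n ∈ (A ε i).support, n ≤ Amax
  arrival_mean : ∀ ε ∈ Set.Ioo (0 : ℝ) 1, ∀ i, arrivalMean (A ε i) = (1 - ε) * ν i
  maxWeight : ∀ ε ∈ Set.Ioo (0 : ℝ) 1, IsMaxWeightRule (rule ε)
  steady : ∀ ε ∈ Set.Ioo (0 : ℝ) 1, IsSteadyState (A ε) (rule ε) (π ε)

/-- `⟨α, q⟩ = α₁ q₁ + α₂ q₂ + α₃ q₃`. -/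
def lin (α : Fin 3 → ℝ) (q : QVec) : ℝ := α 0 * q 0 + α 1 * q 1 + α 2 * q 2

/-- `ε E⟨α, q̄⟩`, where `π` is the law of `q̄`. -/
def scaledMean (π : PMF QVec) (α : Fin 3 → ℝ) (ε : ℝ) : ℝ := ε * ∫ q, lin α q ∂π.toMeasure

/-- The law of `ε ⟨α, q̄⟩`, where `π` is the law of `q̄`. -/
def scaledLaw (π : PMF QVec) (α : Fin 3 → ℝ) (ε : ℝ) : ProbabilityMeasure ℝ :=
  ⟨π.toMeasure.map (fun q => ε * lin α q),
    Measure.isProbabilityMeasure_map (Measurable.of_discrete).aemeasurable⟩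

/-- The polytope of the linear program; `v 0, v 1, v 2` are `v₁, v₂, v₃` and `w 0, …, w 7` are
`w₁, …, w₈`.  The variable `v i` stands for the limit of `ε E[q̄ᵢ]`, and `w` stands for the limits
of the means of `q₁⁺u₂, q₁⁺u₃, q₂⁺u₁, q₂⁺u₃, q₂⁺u₄, q₃⁺u₁, q₃⁺u₂, q₃⁺u₄`, in this order. -/
def polytope (σ : Fin 4 → ℝ) : Set ((Fin 3 → ℝ) × (Fin 8 → ℝ)) :=
  {(v, w) : (Fin 3 → ℝ) × (Fin 8 → ℝ) | (∀ i, 0 ≤ v i) ∧ (∀ i, 0 ≤ w i) ∧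
    v 0 - (w 0 + w 1 - w 4 - w 7) / 2
      = (9 * σ 0 ^ 2 + σ 1 ^ 2 + σ 2 ^ 2 + σ 3 ^ 2) / 16 ∧
    v 1 - (w 2 - w 3 + w 4) / 2
      = (σ 0 ^ 2 + 9 * σ 1 ^ 2 + σ 2 ^ 2 + σ 3 ^ 2) / 16 ∧
    v 2 - (w 5 - w 6 + w 7) / 2
      = (σ 0 ^ 2 + σ 1 ^ 2 + 9 * σ 2 ^ 2 + σ 3 ^ 2) / 16 ∧
    v 0 + v 1 - (3 * w 0 - w 1 + 3 * w 2 + w 3 + w 7) / 2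
      = (3 * σ 0 ^ 2 + 3 * σ 1 ^ 2 - σ 2 ^ 2 - σ 3 ^ 2) / 8 ∧
    v 0 + v 2 - (-w 0 + 3 * w 1 + w 4 + 3 * w 5 + w 6) / 2
      = (3 * σ 0 ^ 2 - σ 1 ^ 2 + 3 * σ 2 ^ 2 - σ 3 ^ 2) / 8 ∧
    v 1 + v 2 - (w 2 + 3 * w 3 + w 4 + w 5 + 3 * w 6 + w 7) / 2
      = (σ 0 ^ 2 - 3 * σ 1 ^ 2 - 3 * σ 2 ^ 2 + σ 3 ^ 2) / 8 ∧
    0 ≤ -v 0 + v 1 + v 2 ∧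
    0 ≤ -w 0 + w 6 ∧
    0 ≤ -w 1 + w 3}

/-- The values `⟨α, v⟩` of the objective function on the polytope. -/
def values (σ : Fin 4 → ℝ) (α : Fin 3 → ℝ) : Set ℝ :=
  {x | ∃ v w, (v, w) ∈ polytope σ ∧ x = α 0 * v 0 + α 1 * v 1 + α 2 * v 2}

/-- The optimal value of the minimization problem. -/
def fLower (σ : Fin 4 → ℝ) (α : Fin 3 → ℝ) : ℝ := sInf (values σ α)

/-- The optimal value of the maximization problem. -/
def fUpper (σ : Fin 4 → ℝ) (α : Fin 3 → ℝ) : ℝ := sSup (values σ α)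

/-- The linear functional `⟨α, ·⟩` is nonnegative on the cone of nonnegative vectors `x` with
`x₁ + x₄ = x₂ + x₃`, into which the scaled queue lengths collapse.  This holds if `α ≥ 0`, and also
if `⟨α, ·⟩` is the fourth coordinate on that cone. -/
def NonnegOnCone (α : Fin 3 → ℝ) : Prop :=
  ∀ x : Fin 4 → ℝ, (∀ i, 0 ≤ x i) → x 0 + x 3 = x 1 + x 2 →
    0 ≤ α 0 * x 0 + α 1 * x 1 + α 2 * x 2

end InputQueuedSwitch

end

noncomputable section

namespace InputQueuedSwitch

/-! A MaxWeight schedule can be enlarged to one of the two perfect matchings {0, 3} and {1, 2} by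
adding service only at empty queues. Wasted service `idle` is measured against this completion. A
linear form `c` with `c 0 + c 3 = c 1 + c 2 = 1 / 2` (`IsNormalized`) takes the value 1/2 on both
matchings and on `ν`, so the increment of ⟨c, q⟩ does not depend on the schedule chosen: it is
arrival noise of mean -ε/2 plus a combination of idle terms. Equating the expected product of two
such forms before and after a slot gives `drift_identity`, which expresses ε E q through the arrival
variances and the means of q⁺ᵢuⱼ and uᵢuⱼ.

Three facts determine the limit. First, the total mean idleness is 2ε (`idle_mean_le`), so the terms
uᵢuⱼ and q⁺ᵢuᵢ disappear. Second, MaxWeight keeps the imbalance q₀ + q₃ - q₁ - q₂ bounded in second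
moment (`imbalance_sq_mean_le`), so the limits of ε E q, and for each j those of E[q⁺ᵢuⱼ], satisfy
the equation of the balanced cone. Third, ε E q and the cross means stay bounded
(`scaled_sum_mean_le`, `exists_crossMean_le`). Hence everything converges along any ultrafilter
tending to 0⁺, and the limit lies in the polytope (`exists_mem_polytope`). The identity is affine in
each of the two forms, and normalized forms make up an affine plane, so the six products of three
affinely independent forms carry all of its content: these are the six equations. The last three
inequalities are the signs of the eliminated variables.

The polytope is compact, so control of all cluster points gives the bounds on liminf and limsup. The
tail bound is Markov's inequality for a bounded continuous test function; ⟨α, q⟩ can be negative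
only by an amount that the imbalance controls. -/

/-! ### Laws of one time slot: queue lengths, schedule, arrivals -/

theorem ae_mem_support {α : Type*} [MeasurableSpace α] [Countable α] [MeasurableSingletonClass α]
    (p : PMF α) : ∀ᵐ x ∂p.toMeasure, x ∈ p.support := by
  rw [ae_iff_of_countable]
  intro a ha
  rw [PMF.toMeasure_apply_singleton _ _ (MeasurableSet.singleton a)] at ha
  exact ha

theorem lintegral_toMeasure {α : Type*} [MeasurableSpace α] [Countable α]
    [MeasurableSingletonClass α] (p : PMF α) (f : α → ENNReal) :
    ∫⁻ x, f x ∂p.toMeasure = ∑' x, p x * f x := by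
  rw [lintegral_countable']
  refine tsum_congr fun a => ?_
  rw [PMF.toMeasure_apply_singleton _ _ (MeasurableSet.singleton a), mul_comm]

/-- Law of the arrivals as a product measure. -/
theorem arrivals_toMeasure (A : Fin 4 → PMF ℕ) :
    (arrivals A).toMeasure = Measure.pi fun i => (A i).toMeasure := by
  refine Measure.ext_of_singleton fun x => ?_
  rw [PMF.toMeasure_apply_singleton _ _ (MeasurableSet.singleton x), Measure.pi_singleton]
  simp only [PMF.toMeasure_apply_singleton _ _ (MeasurableSet.singleton _), Fin.prod_univ_four]
  unfold arrivals
  have key : ∀ a b c d : ℕ, x = ![a, b, c, d] ↔ x 0 = a ∧ x 1 = b ∧ x 2 = c ∧ x 3 = d := by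
    intro a b c d
    constructor
    · rintro rfl
      simp
    · rintro ⟨h0, h1, h2, h3⟩
      funext i
      fin_cases i <;> simp [h0, h1, h2, h3]
  simp only [PMF.bind_apply, PMF.pure_apply, key]
  rw [tsum_eq_single (x 0) (fun b hb => by simp [Ne.symm hb])]
  rw [tsum_eq_single (x 1) (fun b hb => by simp [Ne.symm hb])]
  rw [tsum_eq_single (x 2) (fun b hb => by simp [Ne.symm hb])]
  rw [tsum_eq_single (x 3) (fun b hb => by simp [Ne.symm hb])]
  simp [mul_assoc]

/-- Joint law of the queue lengths and the schedule. -/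
def scheduleLaw (rule : QVec → PMF QVec) (π : PMF QVec) : PMF (QVec × QVec) :=
  π.bind fun q => (rule q).map (Prod.mk q)

/-- Joint law of the queue lengths, the schedule and the arrivals. -/
def jointLaw (A : Fin 4 → PMF ℕ) (rule : QVec → PMF QVec) (π : PMF QVec) :
    Measure ((QVec × QVec) × QVec) :=
  (scheduleLaw rule π).toMeasure.prod (arrivals A).toMeasure

instance (A : Fin 4 → PMF ℕ) (rule : QVec → PMF QVec) (π : PMF QVec) :
    IsProbabilityMeasure (jointLaw A rule π) := by
  unfold jointLaw; infer_instance

/-- Queue lengths at the end of the time slot. -/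
def nextOf (z : (QVec × QVec) × QVec) : QVec := next z.1.1 z.2 z.1.2

theorem scheduleLaw_map_fst (rule : QVec → PMF QVec) (π : PMF QVec) :
    (scheduleLaw rule π).toMeasure.map Prod.fst = π.toMeasure := by
  rw [PMF.toMeasure_map (hf := measurable_fst)]
  congr 1
  unfold scheduleLaw
  rw [PMF.map_bind]
  simp only [PMF.map_comp]
  have h : ∀ q : QVec, PMF.map (Prod.fst ∘ Prod.mk q) (rule q) = PMF.pure q := fun q =>
    PMF.map_const _ _
  simp only [h, PMF.bind_pure]

theorem jointLaw_map_queue (A : Fin 4 → PMF ℕ) (rule : QVec → PMF QVec) (π : PMF QVec) :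
    (jointLaw A rule π).map (fun z => z.1.1) = π.toMeasure := by
  have : (fun z : (QVec × QVec) × QVec => z.1.1) = Prod.fst ∘ Prod.fst := rfl
  rw [this, ← Measure.map_map measurable_fst measurable_fst]
  unfold jointLaw
  rw [Measure.map_fst_prod]
  simp [scheduleLaw_map_fst]

/-- Stationarity enters the proof only through this statement, which puts the queue lengths before
and after a slot on one probability space. -/
theorem jointLaw_map_next {A : Fin 4 → PMF ℕ} {rule : QVec → PMF QVec} {π : PMF QVec}
    (h : IsSteadyState A rule π) :
    (jointLaw A rule π).map nextOf = π.toMeasure := by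
  have hm : Measurable nextOf := Measurable.of_discrete
  refine Measure.ext_of_singleton fun x => ?_
  rw [Measure.map_apply hm (MeasurableSet.singleton x),
    PMF.toMeasure_apply_singleton _ _ (MeasurableSet.singleton x)]
  unfold jointLaw
  rw [Measure.prod_apply (hm (MeasurableSet.singleton x))]
  have h1 : ∀ z : QVec × QVec, (arrivals A).toMeasure (Prod.mk z ⁻¹' (nextOf ⁻¹' {x}))
      = ((arrivals A).bind fun a => PMF.pure (next z.1 a z.2)) x := by
    intro z
    rw [PMF.bind_apply, PMF.toMeasure_apply_eq_tsum]
    refine tsum_congr fun a => ?_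
    by_cases hx : x = next z.1 a z.2
    · simp [Set.indicator, nextOf, hx, PMF.pure_apply]
    · simp [Set.indicator, nextOf, hx, Ne.symm hx, PMF.pure_apply]
  simp only [h1]
  rw [lintegral_toMeasure]
  have h2 : ∑' z : QVec × QVec, (scheduleLaw rule π) z
        * ((arrivals A).bind fun a => PMF.pure (next z.1 a z.2)) x
      = ((scheduleLaw rule π).bind fun z =>
          (arrivals A).bind fun a => PMF.pure (next z.1 a z.2)) x := by
    rw [PMF.bind_apply]
  rw [h2]
  conv_rhs => rw [← h]
  congr 1
  unfold scheduleLaw step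
  rw [PMF.bind_bind]
  simp only [PMF.bind_map]
  rfl

theorem scheduleLaw_ae_maxWeight {rule : QVec → PMF QVec} (π : PMF QVec)
    (hr : IsMaxWeightRule rule) :
    ∀ᵐ z ∂(scheduleLaw rule π).toMeasure, IsMaxWeight z.1 z.2 := by
  filter_upwards [ae_mem_support (scheduleLaw rule π)] with z hz
  unfold scheduleLaw at hz
  rw [PMF.mem_support_bind_iff] at hz
  obtain ⟨q, -, hq⟩ := hz
  rw [PMF.mem_support_map_iff] at hq
  obtain ⟨s, hs, rfl⟩ := hq
  exact hr q s hs

theorem arrivals_ae_le {A : Fin 4 → PMF ℕ} {Amax : ℕ}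
    (hA : ∀ i, ∀ n ∈ (A i).support, n ≤ Amax) :
    ∀ᵐ a ∂(arrivals A).toMeasure, ∀ i, a i ≤ Amax := by
  rw [arrivals_toMeasure, ae_all_iff]
  intro i
  have h := ae_mem_support (A i)
  have := (measurePreserving_eval (fun i => (A i).toMeasure) i).quasiMeasurePreserving.ae h
  filter_upwards [this] with a ha using hA i _ ha

theorem integrable_arrivals {A : Fin 4 → PMF ℕ} {Amax : ℕ}
    (hA : ∀ i, ∀ n ∈ (A i).support, n ≤ Amax) (g : QVec → ℝ) :
    Integrable g (arrivals A).toMeasure := by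
  have hfin : (Set.pi Set.univ fun _ : Fin 4 => Set.Iic Amax).Finite :=
    Set.Finite.pi fun _ => Set.finite_Iic Amax
  obtain ⟨C, hC⟩ := (hfin.image fun a => ‖g a‖).bddAbove
  refine Integrable.of_bound (Measurable.of_discrete).aestronglyMeasurable C ?_
  filter_upwards [arrivals_ae_le hA] with a ha
  exact hC ⟨a, fun i _ => ha i, rfl⟩

theorem integrable_arrivalMarginal {p : PMF ℕ} {Amax : ℕ}
    (hp : ∀ n ∈ p.support, n ≤ Amax) (g : ℕ → ℝ) : Integrable g p.toMeasure := by
  obtain ⟨C, hC⟩ := ((Set.finite_Iic Amax).image fun a => ‖g a‖).bddAbove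
  refine Integrable.of_bound (Measurable.of_discrete).aestronglyMeasurable C ?_
  filter_upwards [ae_mem_support p] with a ha
  exact hC ⟨a, hp a ha, rfl⟩

theorem integral_arrival {A : Fin 4 → PMF ℕ} (g : ℕ → ℝ) (i : Fin 4) :
    ∫ a, g (a i) ∂(arrivals A).toMeasure = ∫ n, g n ∂(A i).toMeasure := by
  rw [arrivals_toMeasure]
  exact integral_comp_eval (μ := fun i => (A i).toMeasure)
    (Measurable.of_discrete).aestronglyMeasurable

theorem integral_centered {A : Fin 4 → PMF ℕ} {Amax : ℕ}
    (hA : ∀ i, ∀ n ∈ (A i).support, n ≤ Amax) (i : Fin 4) :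
    ∫ a, ((a i : ℝ) - arrivalMean (A i)) ∂(arrivals A).toMeasure = 0 := by
  rw [integral_arrival (fun n => (n : ℝ) - arrivalMean (A i)) i,
    integral_sub (integrable_arrivalMarginal (hA i) _) (integrable_const _)]
  simp [arrivalMean]

theorem integral_centered_mul {A : Fin 4 → PMF ℕ} {Amax : ℕ}
    (hA : ∀ i, ∀ n ∈ (A i).support, n ≤ Amax) (i j : Fin 4) :
    ∫ a, ((a i : ℝ) - arrivalMean (A i)) * ((a j : ℝ) - arrivalMean (A j))
      ∂(arrivals A).toMeasure = if i = j then arrivalVar (A i) else 0 := by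
  split_ifs with hij
  · subst hij
    rw [integral_arrival (fun n => ((n : ℝ) - arrivalMean (A i)) * ((n : ℝ) - arrivalMean (A i))) i,
      arrivalVar, variance_eq_integral (Measurable.of_discrete).aemeasurable]
    simp [arrivalMean, sq]
  · have hind : iIndepFun (fun (k : Fin 4) (a : QVec) => (a k : ℝ) - arrivalMean (A k))
        (arrivals A).toMeasure := by
      rw [arrivals_toMeasure]
      exact iIndepFun_pi (X := fun (k : Fin 4) (n : ℕ) => (n : ℝ) - arrivalMean (A k))
        fun k => (Measurable.of_discrete).aemeasurable
    rw [(hind.indepFun hij).integral_fun_mul_eq_mul_integral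
      (Measurable.of_discrete).aestronglyMeasurable (Measurable.of_discrete).aestronglyMeasurable,
      integral_centered hA i, zero_mul]

theorem arrivalVar_nonneg (p : PMF ℕ) : 0 ≤ arrivalVar p := variance_nonneg _ _

/-! ### Stationary expectations without a priori integrability -/

/-- Truncation of a real number to `[-n, n]`. -/
def truncate (n : ℕ) (x : ℝ) : ℝ := max (-(n : ℝ)) (min x n)

theorem continuous_truncate (n : ℕ) : Continuous (truncate n) := by
  unfold truncate; fun_prop

theorem abs_truncate_le (n : ℕ) (x : ℝ) : |truncate n x| ≤ n := by
  unfold truncate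
  have : (0 : ℝ) ≤ n := n.cast_nonneg
  rw [abs_le]
  exact ⟨le_max_left _ _, max_le (by linarith) (min_le_right _ _)⟩

theorem abs_truncate_sub_le (n : ℕ) (x y : ℝ) : |truncate n x - truncate n y| ≤ |x - y| := by
  unfold truncate
  refine (abs_max_sub_max_le_max _ _ _ _).trans ?_
  simp only [sub_self, abs_zero]
  refine max_le (abs_nonneg _) ((abs_min_sub_min_le_max _ _ _ _).trans ?_)
  simp

theorem truncate_eventuallyEq (x : ℝ) : ∀ᶠ n : ℕ in atTop, truncate n x = x := by
  filter_upwards [eventually_ge_atTop ⌈|x|⌉₊] with n hn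
  have h1 : |x| ≤ n := (Nat.le_ceil _).trans (by exact_mod_cast hn)
  rw [abs_le] at h1
  unfold truncate
  rw [min_eq_left h1.2, max_eq_right h1.1]

/-- If two random variables have the same law and their difference is integrable, then the
difference has mean zero, even if the variables themselves are not integrable. -/
theorem integral_sub_eq_zero_of_map_eq {Ω : Type*} [MeasurableSpace Ω] {P : Measure Ω}
    [IsProbabilityMeasure P] {X Y : Ω → ℝ} (hX : Measurable X) (hY : Measurable Y)
    (hXY : P.map X = P.map Y) (hint : Integrable (fun z => X z - Y z) P) :
    ∫ z, (X z - Y z) ∂P = 0 := by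
  have hlim : Tendsto (fun n : ℕ => ∫ z, (truncate n (X z) - truncate n (Y z)) ∂P) atTop
      (𝓝 (∫ z, (X z - Y z) ∂P)) := by
    -- Truncation is 1-Lipschitz, so `|X - Y|` dominates the truncated differences although `X` and
    -- `Y` need not be integrable.
    refine tendsto_integral_of_dominated_convergence (fun z => |X z - Y z|) (fun n => ?_)
      hint.abs (fun n => ?_) ?_
    · exact (((continuous_truncate n).measurable.comp hX).sub
        ((continuous_truncate n).measurable.comp hY)).aestronglyMeasurable
    · exact Eventually.of_forall fun z => abs_truncate_sub_le n _ _
    · refine Eventually.of_forall fun z => tendsto_const_nhds.congr' ?_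
      filter_upwards [truncate_eventuallyEq (X z), truncate_eventuallyEq (Y z)] with n h1 h2
      rw [h1, h2]
  have hzero : ∀ n : ℕ, ∫ z, (truncate n (X z) - truncate n (Y z)) ∂P = 0 := by
    intro n
    have hi : ∀ {Z : Ω → ℝ}, Measurable Z → Integrable (fun z => truncate n (Z z)) P := by
      intro Z hZ
      refine Integrable.of_bound
        ((continuous_truncate n).measurable.comp hZ).aestronglyMeasurable n ?_
      exact Eventually.of_forall fun z => abs_truncate_le n _
    rw [integral_sub (hi hX) (hi hY)]
    have h : ∀ {Z : Ω → ℝ}, Measurable Z →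
        ∫ z, truncate n (Z z) ∂P = ∫ x, truncate n x ∂(P.map Z) := by
      intro Z hZ
      rw [integral_map hZ.aemeasurable (continuous_truncate n).aestronglyMeasurable]
    rw [h hX, h hY, hXY, sub_self]
  simp only [hzero] at hlim
  exact (tendsto_nhds_unique hlim tendsto_const_nhds)

/-- Foster–Lyapunov moment bound in steady state, without a priori integrability. -/
theorem foster_moment_bound {A : Fin 4 → PMF ℕ} {Amax : ℕ} {rule : QVec → PMF QVec}
    {π : PMF QVec} (hA : ∀ i, ∀ n ∈ (A i).support, n ≤ Amax) (hr : IsMaxWeightRule rule)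
    (hπ : IsSteadyState A rule π) (V F : QVec → ℝ) (g : QVec → Fin 4 → ℝ) (K : ℝ)
    (hV : ∀ q, 0 ≤ V q) (hF : ∀ q, 0 ≤ F q) (hK : 0 ≤ K)
    (hdrift : ∀ q s a : QVec, IsMaxWeight q s → (∀ i, a i ≤ Amax) →
      V (next q a s) ≤ V q - F q + K + ∑ i, g q i * ((a i : ℝ) - arrivalMean (A i))) :
    Integrable F π.toMeasure ∧ ∫ q, F q ∂π.toMeasure ≤ K := by
  set R : QVec → ℝ := fun q => V q - F q + K with hR
  set S := (scheduleLaw rule π).toMeasure with hS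
  have hm : ∀ {f : QVec → ℝ} {ρ : Measure QVec}, AEStronglyMeasurable f ρ :=
    (Measurable.of_discrete).aestronglyMeasurable
  -- conditional drift
  have hmean : ∀ q : QVec, ∀ n : ℕ, ∀ s, IsMaxWeight q s →
      ∫ a, min (V (next q a s)) n ∂(arrivals A).toMeasure ≤ min (R q) n := by
    intro q n s hs
    have hi := integrable_arrivals (A := A) hA
    have hlin : ∫ a : QVec, (R q + ∑ i, g q i * ((a i : ℝ) - arrivalMean (A i)))
        ∂(arrivals A).toMeasure = R q := by
      rw [integral_add (hi _) (hi _), integral_finsetSum _ fun i _ => hi _]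
      simp [integral_const_mul, integral_centered hA]
    refine le_min ?_ ?_
    · rw [← hlin]
      refine integral_mono_ae (hi _) (hi _) ?_
      filter_upwards [arrivals_ae_le hA] with a ha
      exact (min_le_left _ _).trans (hdrift q s a hs ha)
    · calc ∫ a, min (V (next q a s)) n ∂(arrivals A).toMeasure
          ≤ ∫ a, (n : ℝ) ∂(arrivals A).toMeasure :=
            integral_mono (hi _) (hi _) fun a => min_le_right _ _
        _ = n := by simp
  have hgood := scheduleLaw_ae_maxWeight (π := π) hr
  -- This is the truncation level 0 of the conditional drift; it makes `min (R q) n` bounded.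
  have hRnn : ∀ᵐ z ∂S, 0 ≤ R z.1 := by
    filter_upwards [hgood] with z hz
    have hi := integrable_arrivals (A := A) hA
    have h0 := hmean z.1 0 z.2 hz
    have : (0 : ℝ) ≤ ∫ a, min (V (next z.1 a z.2)) ((0 : ℕ) : ℝ) ∂(arrivals A).toMeasure := by
      refine integral_nonneg fun a => ?_
      simp [hV]
    exact (this.trans h0).trans (min_le_left _ _)
  have hbd : ∀ {Ω : Type} [MeasurableSpace Ω] {P : Measure Ω} [IsFiniteMeasure P] {f : Ω → ℝ}
      (n : ℕ), Measurable f → (∀ᵐ z ∂P, 0 ≤ f z) → Integrable (fun z => min (f z) (n : ℝ)) P := by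
    intro Ω _ P _ f n hf h
    refine Integrable.of_bound (hf.min measurable_const).aestronglyMeasurable (n : ℝ) ?_
    filter_upwards [h] with z hz
    rw [Real.norm_eq_abs, abs_of_nonneg (le_min hz n.cast_nonneg)]
    exact min_le_right _ _
  have hstep : ∀ n : ℕ, ∫ q, min (V q) n ∂π.toMeasure ≤ ∫ z, min (R z.1) n ∂S := by
    intro n
    have hnm : Measurable nextOf := Measurable.of_discrete
    rw [← jointLaw_map_next hπ, integral_map hnm.aemeasurable hm]
    unfold jointLaw
    rw [integral_prod]
    · refine integral_mono_ae ?_ (hbd n Measurable.of_discrete hRnn) ?_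
      · refine Integrable.integral_prod_left (f := fun z => min (V (nextOf z)) (n : ℝ)) ?_
        exact hbd n Measurable.of_discrete (Eventually.of_forall fun z => hV _)
      · filter_upwards [hgood] with z hz using hmean z.1 n z.2 hz
    · exact hbd n Measurable.of_discrete (Eventually.of_forall fun z => hV _)
  have hSπ : ∀ f : QVec → ℝ, ∫ z, f z.1 ∂S = ∫ q, f q ∂π.toMeasure := by
    intro f
    rw [← scheduleLaw_map_fst rule π, integral_map measurable_fst.aemeasurable hm]
  have hRπ : ∀ᵐ q ∂π.toMeasure, 0 ≤ R q := by
    rw [← scheduleLaw_map_fst rule π]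
    rw [ae_map_iff measurable_fst.aemeasurable MeasurableSet.of_discrete]
    exact hRnn
  have hV' : ∀ᵐ q ∂π.toMeasure, 0 ≤ V q := Eventually.of_forall hV
  -- The summand `K` makes the integrand nonnegative, and for large `n` the integrand equals `K + V
  -- q - R q = F q`. Fatou's lemma then bounds the mean of `F` without integrability of `V`.
  have hstep' : ∀ n : ℕ, ∫ q, (K + (min (V q) n - min (R q) n)) ∂π.toMeasure ≤ K := by
    intro n
    have h := hstep n
    rw [hSπ (fun q => min (R q) (n : ℝ))] at h
    have hVR : Integrable (fun q => min (V q) (n : ℝ) - min (R q) n) π.toMeasure :=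
      (hbd n Measurable.of_discrete hV').sub (hbd n Measurable.of_discrete hRπ)
    rw [integral_add (integrable_const _) hVR, integral_sub (hbd n Measurable.of_discrete hV') (hbd n Measurable.of_discrete hRπ)]
    simp
    linarith
  have hnn : ∀ n : ℕ, ∀ q, 0 ≤ K + (min (V q) n - min (R q) n) := by
    intro n q
    have h1 : min (R q) n ≤ min (V q) n + K := by
      rcases le_total (V q) n with h | h
      · rw [min_eq_left h]
        have := hF q
        exact (min_le_left _ _).trans (by simp only [hR]; linarith)
      · rw [min_eq_right h]
        exact (min_le_right _ _).trans (by linarith)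
    linarith
  have hlim : ∀ q, ENNReal.ofReal (F q)
      ≤ liminf (fun n : ℕ => ENNReal.ofReal (K + (min (V q) n - min (R q) n))) atTop := by
    intro q
    refine le_liminf_of_le (by isBoundedDefault) ?_
    filter_upwards [eventually_ge_atTop ⌈max (V q) (R q)⌉₊] with n hn
    have h1 : max (V q) (R q) ≤ n := (Nat.le_ceil _).trans (by exact_mod_cast hn)
    rw [min_eq_left ((le_max_left _ _).trans h1), min_eq_left ((le_max_right _ _).trans h1)]
    refine ENNReal.ofReal_le_ofReal ?_
    simp only [hR]
    linarith
  have hlint : ∫⁻ q, ENNReal.ofReal (F q) ∂π.toMeasure ≤ ENNReal.ofReal K := by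
    refine (lintegral_mono hlim).trans ((lintegral_liminf_le fun n => Measurable.of_discrete).trans ?_)
    refine liminf_le_of_le (by isBoundedDefault) fun b hb => ?_
    obtain ⟨n, hn⟩ := hb.exists
    refine hn.trans ?_
    rw [← ofReal_integral_eq_lintegral_ofReal]
    · exact ENNReal.ofReal_le_ofReal (hstep' n)
    · exact (integrable_const _).add
        ((hbd n Measurable.of_discrete hV').sub (hbd n Measurable.of_discrete hRπ))
    · exact Eventually.of_forall (hnn n)
  have hint : Integrable F π.toMeasure := by
    refine ⟨hm, ?_⟩
    rw [hasFiniteIntegral_iff_ofReal (Eventually.of_forall hF)]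
    exact hlint.trans_lt ENNReal.ofReal_lt_top
  refine ⟨hint, ?_⟩
  rw [← ENNReal.ofReal_le_ofReal_iff hK,
    ofReal_integral_eq_lintegral_ofReal hint (Eventually.of_forall hF)]
  exact hlint

/-! ### Completed schedules and idle service -/

/-- A maximal schedule containing `s`. -/
def completion (s : QVec) : QVec := if s 1 = 0 ∧ s 2 = 0 then ![1, 0, 0, 1] else ![0, 1, 1, 0]

theorem isSchedule_diag : IsSchedule ![1, 0, 0, 1] := by
  refine ⟨fun i => ?_, ?_⟩
  · fin_cases i <;> simp
  · simp

theorem isSchedule_antidiag : IsSchedule ![0, 1, 1, 0] := by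
  refine ⟨fun i => ?_, ?_⟩
  · fin_cases i <;> simp
  · simp

theorem completion_eq (s : QVec) :
    (completion s 0 = 1 ∧ completion s 1 = 0 ∧ completion s 2 = 0 ∧ completion s 3 = 1) ∨
    (completion s 0 = 0 ∧ completion s 1 = 1 ∧ completion s 2 = 1 ∧ completion s 3 = 0) := by
  unfold completion
  split_ifs
  · left; simp
  · right; simp

/-- A nonempty queue added by the completion would increase the weight, contradicting maximality.
The empty schedule is completed to the diagonal. -/
theorem completion_spec {q s : QVec} (h : IsMaxWeight q s) (i : Fin 4) :
    s i ≤ completion s i ∧ completion s i ≤ 1 ∧ (s i ≠ completion s i → q i = 0) := by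
  obtain ⟨⟨h1, h2, h3, h4, h5⟩, hm⟩ := h
  have hd := hm _ isSchedule_diag
  have ha := hm _ isSchedule_antidiag
  simp only [weight, Fin.sum_univ_four] at hd ha
  simp at hd ha
  have b0 := h1 0
  have b1 := h1 1
  have b2 := h1 2
  have b3 := h1 3
  unfold completion
  have e : ∀ i, s i = 0 ∨ s i = 1 := fun i => by have := h1 i; omega
  rcases e 0 with e0 | e0 <;> rcases e 1 with e1 | e1 <;> rcases e 2 with e2 | e2 <;>
    rcases e 3 with e3 | e3 <;> simp only [e0, e1, e2, e3] at h2 h3 h4 h5 hd ha ⊢ <;>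
    first
    | omega
    | (fin_cases i <;> simp [e0, e1, e2, e3] at hd ha ⊢ <;> omega)

/-- The completion of a MaxWeight schedule also has maximum weight. -/
theorem le_weight_completion {q s : QVec} (h : IsMaxWeight q s) :
    q 0 + q 3 ≤ ∑ i, q i * completion s i ∧ q 1 + q 2 ≤ ∑ i, q i * completion s i := by
  have hle : weight q s ≤ ∑ i, q i * completion s i :=
    Finset.sum_le_sum fun i _ => Nat.mul_le_mul_left _ (completion_spec h i).1
  have hd := h.2 _ isSchedule_diag
  have ha := h.2 _ isSchedule_antidiag
  refine ⟨le_trans ?_ (hd.trans hle), le_trans ?_ (ha.trans hle)⟩ <;>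
    simp [weight, Fin.sum_univ_four]

/-- Unused service with respect to the completed schedule. -/
def idle (q a s : QVec) (i : Fin 4) : ℝ :=
  (next q a s i : ℝ) - q i - a i + completion s i

/-- Idleness has two sources: true unused service, which leaves the queue empty, and service added
by the completion at an empty queue, which ends the slot with its arrivals. In the second case the
new length can be positive, so `next * idle` is only bounded by the arrivals and need not vanish. -/
theorem idle_cases {q s : QVec} (h : IsMaxWeight q s) (a : QVec) (i : Fin 4) :
    idle q a s i = 0 ∨ (idle q a s i = 1 ∧ q i = 0 ∧ next q a s i ≤ a i) := by
  obtain ⟨h1, h2, h3⟩ := completion_spec h i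
  have hn := next_add q a s i
  have hu : unused q a s i = s i - min (s i) (q i + a i) := rfl
  have hU : idle q a s i
      = ((unused q a s i : ℕ) : ℝ) + ((completion s i : ℕ) : ℝ) - ((s i : ℕ) : ℝ) := by
    have : ((next q a s i + s i : ℕ) : ℝ) = ((q i + a i + unused q a s i : ℕ) : ℝ) := by rw [hn]
    push_cast at this
    unfold idle
    linarith
  rw [hU]
  by_cases hc : s i = completion s i
  · rw [hc, add_sub_cancel_right]
    have : unused q a s i = 0 ∨ (unused q a s i = 1 ∧ q i = 0 ∧ next q a s i ≤ a i) := by omega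
    exact_mod_cast this
  · right
    have hq := h3 hc
    have hs : s i = 0 := by omega
    have hc1 : completion s i = 1 := by omega
    have hu0 : unused q a s i = 0 := by omega
    refine ⟨?_, hq, by omega⟩
    rw [hs, hc1, hu0]
    simp

theorem idle_nonneg {q s : QVec} (h : IsMaxWeight q s) (a : QVec) (i : Fin 4) :
    0 ≤ idle q a s i := by
  rcases idle_cases h a i with h | ⟨h, -⟩ <;> rw [h]
  exact zero_le_one

theorem idle_le_one {q s : QVec} (h : IsMaxWeight q s) (a : QVec) (i : Fin 4) :
    idle q a s i ≤ 1 := by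
  rcases idle_cases h a i with h | ⟨h, -⟩ <;> rw [h]
  exact zero_le_one

theorem mul_idle {q s : QVec} (h : IsMaxWeight q s) (a : QVec) (i : Fin 4) :
    (q i : ℝ) * idle q a s i = 0 := by
  rcases idle_cases h a i with h | ⟨h, h', -⟩
  · simp [h]
  · simp [h']

theorem next_mul_idle_le {q s : QVec} (h : IsMaxWeight q s) (a : QVec) (i : Fin 4) :
    (next q a s i : ℝ) * idle q a s i ≤ a i * idle q a s i := by
  rcases idle_cases h a i with h | ⟨h, -, h'⟩
  · simp [h]
  · rw [h]
    simpa using h'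

theorem next_eq (q a s : QVec) (i : Fin 4) :
    (next q a s i : ℝ) = q i + (a i - completion s i + idle q a s i) := by
  unfold idle; ring

theorem abs_increment_le {q s a : QVec} (h : IsMaxWeight q s) {Amax : ℕ}
    (ha : ∀ i, a i ≤ Amax) (i : Fin 4) :
    |(a i : ℝ) - completion s i + idle q a s i| ≤ Amax + 1 := by
  have h1 : (a i : ℝ) ≤ Amax := by exact_mod_cast ha i
  have h2 : (0 : ℝ) ≤ a i := (a i).cast_nonneg
  have h3 : (completion s i : ℝ) ≤ 1 := by exact_mod_cast (completion_spec h i).2.1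
  have h4 : (0 : ℝ) ≤ completion s i := (completion s i).cast_nonneg
  have h5 := idle_nonneg h a i
  have h6 := idle_le_one h a i
  rw [abs_le]
  constructor <;> linarith

/-- Signed imbalance of the two maximal schedules. -/
def imbalance (q : QVec) : ℝ := (q 0 : ℝ) + q 3 - q 1 - q 2

/-- The saturated `ν` is the convex combination of the two matchings with weights `ν 0` and `1 - ν
0`, both at least `m`, and the completion serves the heavier matching. The loss is the gap between
the matchings times the weight of the lighter one. -/
theorem sum_rate_sub_completion_le {ν : Fin 4 → ℝ} (hν : IsSaturated ν) {m : ℝ}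
    (hm : ∀ i, m ≤ ν i) {q s : QVec} (h : IsMaxWeight q s) :
    ∑ i, (q i : ℝ) * (ν i - completion s i) ≤ -m * |imbalance q| := by
  obtain ⟨hpos, h1, h2, h3, h4⟩ := hν
  have hw := le_weight_completion h
  have hw1 : (q 0 : ℝ) + q 3 ≤ ∑ i, (q i : ℝ) * completion s i := by exact_mod_cast hw.1
  have hw2 : (q 1 : ℝ) + q 2 ≤ ∑ i, (q i : ℝ) * completion s i := by exact_mod_cast hw.2
  simp only [mul_sub, Finset.sum_sub_distrib]
  have e1 : ν 1 = 1 - ν 0 := by linarith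
  have e2 : ν 2 = 1 - ν 0 := by linarith
  have e3 : ν 3 = ν 0 := by linarith
  have hs : ∑ i, (q i : ℝ) * ν i
      = ν 0 * ((q 0 : ℝ) + q 3) + (1 - ν 0) * ((q 1 : ℝ) + q 2) := by
    rw [Fin.sum_univ_four, e1, e2, e3]; ring
  rw [hs]
  have m0 := hm 0
  have m1 := hm 1
  rw [e1] at m1
  unfold imbalance
  rcases le_total 0 ((q 0 : ℝ) + q 3 - q 1 - q 2) with hd | hd
  · rw [abs_of_nonneg hd]
    nlinarith
  · rw [abs_of_nonpos hd]
    nlinarith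

/-! ### Geometry of the balanced cone -/

/-- The cone into which the scaled queue lengths collapse. -/
def balancedCone : Set (Fin 4 → ℝ) := {x | (∀ i, 0 ≤ x i) ∧ x 0 + x 3 = x 1 + x 2}

theorem isClosed_balancedCone : IsClosed balancedCone := by
  have h : balancedCone = (⋂ i, {x : Fin 4 → ℝ | 0 ≤ x i}) ∩ {x | x 0 + x 3 = x 1 + x 2} := by
    ext x; simp [balancedCone]
  rw [h]
  exact (isClosed_iInter fun i => isClosed_le (by fun_prop) (by fun_prop)).inter
    (isClosed_eq (by fun_prop) (by fun_prop))

theorem exists_projection (q : Fin 4 → ℝ) :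
    ∃ p ∈ balancedCone, ∀ x ∈ balancedCone, ∑ i, (q i - p i) ^ 2 ≤ ∑ i, (q i - x i) ^ 2 := by
  set S : Set (EuclideanSpace ℝ (Fin 4)) := {x | (x : Fin 4 → ℝ) ∈ balancedCone} with hS
  have hcl : IsClosed S := isClosed_balancedCone.preimage (by fun_prop)
  have hne : S.Nonempty := ⟨0, by simp [hS, balancedCone]⟩
  obtain ⟨p, hp, hd⟩ := hcl.exists_infDist_eq_dist hne (WithLp.toLp 2 q)
  refine ⟨p, hp, fun x hx => ?_⟩
  have h1 : dist (WithLp.toLp 2 q) p ≤ dist (WithLp.toLp 2 q) (WithLp.toLp 2 x) := by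
    rw [← hd]
    exact Metric.infDist_le_dist_of_mem (show WithLp.toLp 2 x ∈ S from hx)
  rw [EuclideanSpace.dist_eq, EuclideanSpace.dist_eq,
    Real.sqrt_le_sqrt_iff (Finset.sum_nonneg fun i _ => sq_nonneg _)] at h1
  simpa [Real.dist_eq, sq_abs] using h1

/-- The surplus d of the heavier matching is removed from its two queues in parts t and d - t, and
t² + (d - t)² ≤ d². -/
theorem exists_balancedCone_near (q : Fin 4 → ℝ) (hq : ∀ i, 0 ≤ q i) :
    ∃ x ∈ balancedCone, ∑ i, (q i - x i) ^ 2 ≤ (q 0 + q 3 - q 1 - q 2) ^ 2 := by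
  have key : ∀ a b d : ℝ, 0 ≤ a → 0 ≤ b → 0 ≤ d → d ≤ a + b →
      ∃ t, 0 ≤ t ∧ t ≤ d ∧ 0 ≤ a - t ∧ 0 ≤ b - (d - t) := by
    intro a b d ha hb hd h
    refine ⟨min a d, le_min ha hd, min_le_right _ _, by linarith [min_le_left a d], ?_⟩
    rcases le_total a d with h' | h'
    · rw [min_eq_left h']; linarith
    · rw [min_eq_right h']; linarith
  have h0 := hq 0
  have h1 := hq 1
  have h2 := hq 2
  have h3 := hq 3
  rcases le_total 0 (q 0 + q 3 - q 1 - q 2) with hd | hd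
  · obtain ⟨t, t0, t1, t2, t3⟩ := key (q 0) (q 3) _ h0 h3 hd (by linarith)
    refine ⟨![q 0 - t, q 1, q 2, q 3 - ((q 0 + q 3 - q 1 - q 2) - t)], ⟨fun i => ?_, ?_⟩, ?_⟩
    · fin_cases i <;> simp <;> linarith
    · simp; ring
    · simp [Fin.sum_univ_four]; nlinarith
  · obtain ⟨t, t0, t1, t2, t3⟩ := key (q 1) (q 2) (-(q 0 + q 3 - q 1 - q 2)) h1 h2
      (by linarith) (by linarith)
    refine ⟨![q 0, q 1 - t, q 2 - (-(q 0 + q 3 - q 1 - q 2) - t), q 3], ⟨fun i => ?_, ?_⟩, ?_⟩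
    · fin_cases i <;> simp <;> linarith
    · simp; ring
    · simp [Fin.sum_univ_four]; nlinarith

theorem IsSaturated.lt_one {ν : Fin 4 → ℝ} (hν : IsSaturated ν) (i : Fin 4) : ν i < 1 := by
  obtain ⟨hpos, h1, h2, h3, h4⟩ := hν
  have p0 := hpos 0
  have p1 := hpos 1
  have p2 := hpos 2
  have p3 := hpos 3
  fin_cases i <;> simp <;> linarith

/-! ### Moment bounds from Lyapunov functions -/

section Drift

variable {A : Fin 4 → PMF ℕ} {Amax : ℕ} {rule : QVec → PMF QVec} {π : PMF QVec} {ν : Fin 4 → ℝ}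
  {ε m : ℝ}

/-- The Lyapunov function is Σ qᵢ². Idle service is orthogonal to `q` and MaxWeight does at least as
well as `ν`, so the conditional drift is at most -2ε⟨q, ν⟩ plus the squared increments, and ⟨q, ν⟩ ≥
m Σ qᵢ. -/
theorem scaled_sum_mean_le (hA : ∀ i, ∀ n ∈ (A i).support, n ≤ Amax)
    (hr : IsMaxWeightRule rule) (hπ : IsSteadyState A rule π) (hν : IsSaturated ν)
    (hmean : ∀ i, arrivalMean (A i) = (1 - ε) * ν i) (hε : 0 < ε) (hm : 0 < m)
    (hmν : ∀ i, m ≤ ν i) :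
    Integrable (fun q : QVec => ∑ i, (q i : ℝ)) π.toMeasure ∧
      ε * ∫ q, ∑ i, (q i : ℝ) ∂π.toMeasure ≤ 4 * ((Amax : ℝ) + 1) ^ 2 / (2 * m) := by
  have hpos : 0 < 2 * ε * m := by positivity
  obtain ⟨h1, h2⟩ := foster_moment_bound hA hr hπ (fun q => ∑ i, (q i : ℝ) ^ 2)
    (fun q => 2 * ε * m * ∑ i, (q i : ℝ)) (fun q i => 2 * q i) (4 * ((Amax : ℝ) + 1) ^ 2)
    (fun q => by positivity) (fun q => by positivity) (by positivity) (by
      intro q s a hs ha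
      set x : Fin 4 → ℝ := fun i => (a i : ℝ) - completion s i + idle q a s i with hx
      have hx2 : ∑ i, x i ^ 2 ≤ 4 * ((Amax : ℝ) + 1) ^ 2 := by
        have : ∀ i ∈ Finset.univ, x i ^ 2 ≤ ((Amax : ℝ) + 1) ^ 2 := fun i _ =>
          sq_le_sq' (neg_le_of_abs_le (abs_increment_le hs ha i))
            (le_of_abs_le (abs_increment_le hs ha i))
        refine (Finset.sum_le_sum this).trans ?_
        simp
      have e1 : ∑ i, (next q a s i : ℝ) ^ 2
          = ∑ i, (q i : ℝ) ^ 2 + 2 * ∑ i, (q i : ℝ) * x i + ∑ i, x i ^ 2 := by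
        rw [Finset.mul_sum, ← Finset.sum_add_distrib, ← Finset.sum_add_distrib]
        refine Finset.sum_congr rfl fun i _ => ?_
        rw [next_eq]
        ring
      have e2 : ∑ i, (q i : ℝ) * x i = ∑ i, (q i : ℝ) * ((a i : ℝ) - arrivalMean (A i))
          + ∑ i, (q i : ℝ) * (ν i - completion s i) - ε * ∑ i, (q i : ℝ) * ν i := by
        rw [Finset.mul_sum, ← Finset.sum_add_distrib, ← Finset.sum_sub_distrib]
        refine Finset.sum_congr rfl fun i _ => ?_
        have := mul_idle hs a i
        rw [hmean i]
        simp only [hx]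
        linear_combination this
      have e3 := sum_rate_sub_completion_le hν hmν hs
      have e4 : m * ∑ i, (q i : ℝ) ≤ ∑ i, (q i : ℝ) * ν i := by
        rw [Finset.mul_sum]
        refine Finset.sum_le_sum fun i _ => ?_
        rw [mul_comm]
        exact mul_le_mul_of_nonneg_left (hmν i) (q i).cast_nonneg
      have e5 : 0 ≤ m * |imbalance q| := by positivity
      have e6 : ε * (m * ∑ i, (q i : ℝ)) ≤ ε * ∑ i, (q i : ℝ) * ν i :=
        mul_le_mul_of_nonneg_left e4 hε.le
      have e7 : ∑ i, 2 * (q i : ℝ) * ((a i : ℝ) - arrivalMean (A i))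
          = 2 * ∑ i, (q i : ℝ) * ((a i : ℝ) - arrivalMean (A i)) := by
        rw [Finset.mul_sum]
        exact Finset.sum_congr rfl fun i _ => by ring
      rw [e1, e2, e7]
      linarith)
  have hint : Integrable (fun q : QVec => ∑ i, (q i : ℝ)) π.toMeasure := by
    have := h1.const_mul (2 * ε * m)⁻¹
    refine this.congr (Eventually.of_forall fun q => ?_)
    simp only
    rw [← mul_assoc, inv_mul_cancel₀ hpos.ne', one_mul]
  refine ⟨hint, ?_⟩
  rw [integral_const_mul] at h2
  rw [le_div_iff₀ (by positivity)]
  linarith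

/-- Beyond y = B / c the cubic term outweighs the quadratic one; below it the quadratic term is at
most its value there. -/
theorem cubic_drift_le {c B D y : ℝ} (hc : 0 < c) (hB : 0 ≤ B) (h0 : 0 ≤ y) :
    -c * y ^ 3 + B * y ^ 2 + D ≤ B * (B / c) ^ 2 + D := by
  rcases le_total y (B / c) with h | h
  · have : y ^ 2 ≤ (B / c) ^ 2 := pow_le_pow_left₀ h0 h 2
    nlinarith [mul_nonneg hc.le (pow_nonneg h0 3), mul_le_mul_of_nonneg_left this hB]
  · have h1 : B ≤ c * y := by rwa [div_le_iff₀ hc, mul_comm] at h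
    have h2 : 0 ≤ y ^ 2 * (c * y - B) := mul_nonneg (sq_nonneg _) (by linarith)
    have h3 : 0 ≤ B * (B / c) ^ 2 := by positivity
    nlinarith

/-- State space collapse: the imbalance has second moments bounded uniformly in heavy traffic. -/
theorem imbalance_sq_mean_le (hA : ∀ i, ∀ n ∈ (A i).support, n ≤ Amax)
    (hr : IsMaxWeightRule rule) (hπ : IsSteadyState A rule π) (hν : IsSaturated ν)
    (hmean : ∀ i, arrivalMean (A i) = (1 - ε) * ν i) (hε : 0 < ε) (hε1 : ε < 1) (hm : 0 < m)
    (hmν : ∀ i, m ≤ ν i) (hεm : ε ≤ m / 4) {b : ℝ} (hb : b = Amax + 1) :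
    Integrable (fun q : QVec => imbalance q ^ 2) π.toMeasure ∧
      ∫ q, imbalance q ^ 2 ∂π.toMeasure ≤
        4 * ((170 * b ^ 2 + 1) * ((170 * b ^ 2 + 1) / (2 * m)) ^ 2 + 32 * b ^ 4) := by
  set B : ℝ := 170 * b ^ 2 + 1 with hB
  have hm1 : m ≤ 1 := (hmν 0).trans (hν.lt_one 0).le
  have hb1 : 1 ≤ b := by rw [hb]; linarith [(Nat.cast_nonneg Amax : (0 : ℝ) ≤ Amax)]
  choose proj hproj hmin using fun q : QVec => exists_projection fun i => (q i : ℝ)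
  set N : QVec → ℝ := fun q => ∑ i, ((q i : ℝ) - proj q i) ^ 2 with hN
  have hN0 : ∀ q, 0 ≤ N q := fun q => Finset.sum_nonneg fun i _ => sq_nonneg _
  have hNd : ∀ q, N q ≤ imbalance q ^ 2 := by
    intro q
    obtain ⟨x, hx, hle⟩ := exists_balancedCone_near (fun i => (q i : ℝ)) fun i => (q i).cast_nonneg
    exact (hmin q x hx).trans hle
  -- The imbalance vanishes on the cone, so that of `q` is a signed sum of the four entries of `q -
  -- proj q`; Cauchy–Schwarz gives the factor 4.
  have hdN : ∀ q, imbalance q ^ 2 ≤ 4 * N q := by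
    intro q
    have := (hproj q).2
    have e : imbalance q = ((q 0 : ℝ) - proj q 0) + (q 3 - proj q 3) - (q 1 - proj q 1)
        - (q 2 - proj q 2) := by
      unfold imbalance; linarith
    rw [e]
    simp only [hN, Fin.sum_univ_four]
    generalize (q 0 : ℝ) - proj q 0 = r0
    generalize (q 1 : ℝ) - proj q 1 = r1
    generalize (q 2 : ℝ) - proj q 2 = r2
    generalize (q 3 : ℝ) - proj q 3 = r3
    linarith [sq_nonneg (r0 - r3), sq_nonneg (r0 + r1), sq_nonneg (r0 + r2), sq_nonneg (r3 + r1),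
      sq_nonneg (r3 + r2), sq_nonneg (r1 - r2)]
  -- With y the distance to the cone, the Lyapunov function is y⁴; its drift has leading term -2m
  -- y³, enough to control y². In `B`, 162 b² comes from `D ^ 2`, 8 b² from the squared increments,
  -- and 1 pays for the subtracted `N q = y²`.
  obtain ⟨h1, h2⟩ := foster_moment_bound hA hr hπ (fun q => N q ^ 2) N
    (fun q i => 4 * N q * (q i - proj q i)) (B * (B / (2 * m)) ^ 2 + 32 * b ^ 4)
    (fun q => sq_nonneg _) hN0 (by positivity) (by
      intro q s a hs ha
      set x : Fin 4 → ℝ := fun i => (a i : ℝ) - completion s i + idle q a s i with hx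
      set r : Fin 4 → ℝ := fun i => (q i : ℝ) - proj q i with hr
      set y := √(N q) with hy
      have hy0 : 0 ≤ y := Real.sqrt_nonneg _
      have hyN : y ^ 2 = N q := Real.sq_sqrt (hN0 q)
      have hyd : y ≤ |imbalance q| := by
        rw [hy, ← Real.sqrt_sq_eq_abs]
        exact Real.sqrt_le_sqrt (hNd q)
      have hry : ∀ i, |r i| ≤ y := by
        intro i
        rw [hy, ← Real.sqrt_sq_eq_abs]
        refine Real.sqrt_le_sqrt ?_
        exact Finset.single_le_sum (f := fun i => r i ^ 2) (fun i _ => sq_nonneg _)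
          (Finset.mem_univ i)
      have hx2 : ∑ i, x i ^ 2 ≤ 4 * b ^ 2 := by
        have : ∀ i ∈ Finset.univ, x i ^ 2 ≤ b ^ 2 := fun i _ => by
          rw [hb]
          exact sq_le_sq' (neg_le_of_abs_le (abs_increment_le hs ha i))
            (le_of_abs_le (abs_increment_le hs ha i))
        refine (Finset.sum_le_sum this).trans ?_
        simp
      -- The old projection `proj q` serves as a competitor for the new state, so no regularity of
      -- the projection is needed.
      have e1 : N (next q a s) ≤ N q + 2 * ∑ i, r i * x i + ∑ i, x i ^ 2 := by
        refine (hmin (next q a s) (proj q) (hproj q)).trans (le_of_eq ?_)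
        simp only [hN]
        rw [Finset.mul_sum, ← Finset.sum_add_distrib, ← Finset.sum_add_distrib]
        refine Finset.sum_congr rfl fun i _ => ?_
        rw [next_eq]
        ring
      set L := ∑ i, r i * ((a i : ℝ) - arrivalMean (A i)) with hL
      have e2 : ∑ i, r i * x i = L + ∑ i, (q i : ℝ) * (ν i - completion s i)
          - ∑ i, proj q i * (ν i - completion s i) - ε * ∑ i, r i * ν i
          - ∑ i, proj q i * idle q a s i := by
        rw [hL, Finset.mul_sum, ← Finset.sum_add_distrib, ← Finset.sum_sub_distrib,
          ← Finset.sum_sub_distrib, ← Finset.sum_sub_distrib]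
        refine Finset.sum_congr rfl fun i _ => ?_
        have := mul_idle hs a i
        rw [hmean i]
        simp only [hx, hr]
        linear_combination this
      have e3 := sum_rate_sub_completion_le hν hmν hs
      -- Points of the cone give both matchings the same weight, hence also their convex combination
      -- `ν`.
      have e4 : ∑ i, proj q i * (ν i - completion s i) = 0 := by
        have hp := (hproj q).2
        obtain ⟨-, n1, n2, n3, n4⟩ := hν
        rw [Fin.sum_univ_four]
        have f1 : ν 1 = 1 - ν 0 := by linarith
        have f2 : ν 2 = 1 - ν 0 := by linarith
        have f3 : ν 3 = ν 0 := by linarith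
        rw [f1, f2, f3]
        rcases completion_eq s with ⟨c0, c1, c2, c3⟩ | ⟨c0, c1, c2, c3⟩ <;>
          rw [c0, c1, c2, c3] <;> push_cast
        · linear_combination (ν 0 - 1) * hp
        · linear_combination (ν 0) * hp
      have e5 : 0 ≤ ∑ i, proj q i * idle q a s i :=
        Finset.sum_nonneg fun i _ => mul_nonneg ((hproj q).1 i) (idle_nonneg hs a i)
      have e6 : -(∑ i, r i * ν i) ≤ 2 * y := by
        have : ∀ i ∈ Finset.univ, -(r i * ν i) ≤ y * ν i := fun i _ => by
          rw [← neg_mul]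
          exact mul_le_mul_of_nonneg_right ((neg_le_abs _).trans (hry i)) (hν.1 i).le
        have h := Finset.sum_le_sum this
        rw [Finset.sum_neg_distrib, ← Finset.mul_sum] at h
        have : ∑ i, ν i = 2 := by
          rw [Fin.sum_univ_four]; linarith [hν.2.1, hν.2.2.1]
        rw [this] at h
        linarith
      -- Here `ε ≤ m / 4` lets the collapse drift -m y absorb the heavy-traffic term, leaving half
      -- of it.
      have e7 : ε * -(∑ i, r i * ν i) ≤ m / 2 * y := by
        refine (mul_le_mul_of_nonneg_left e6 hε.le).trans ?_
        nlinarith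
      have e8 : m * y ≤ m * |imbalance q| := mul_le_mul_of_nonneg_left hyd hm.le
      set D := 2 * L - m * y + 4 * b ^ 2 with hD
      have e9 : N (next q a s) ≤ N q + D := by
        rw [hD]
        linarith
      have hLb : |L| ≤ 4 * b * y := by
        rw [hL]
        refine (Finset.abs_sum_le_sum_abs _ _).trans ?_
        have : ∀ i ∈ Finset.univ, |r i * ((a i : ℝ) - arrivalMean (A i))| ≤ y * b := fun i _ => by
          rw [abs_mul]
          refine mul_le_mul (hry i) ?_ (abs_nonneg _) hy0
          have g1 : (a i : ℝ) ≤ Amax := by exact_mod_cast ha i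
          have g2 : (0 : ℝ) ≤ a i := (a i).cast_nonneg
          have g3 : 0 ≤ (1 - ε) * ν i := mul_nonneg (by linarith) (hν.1 i).le
          have g4 : (1 - ε) * ν i ≤ 1 * 1 :=
            mul_le_mul (by linarith) (hν.lt_one i).le (hν.1 i).le zero_le_one
          rw [hmean i, abs_le]
          constructor <;> linarith
        refine (Finset.sum_le_sum this).trans (le_of_eq ?_)
        simp
        ring
      have hDb : |D| ≤ 9 * b * y + 4 * b ^ 2 := by
        rw [abs_le] at hLb ⊢
        have g1 : m * y ≤ b * y := mul_le_mul_of_nonneg_right (hm1.trans hb1) hy0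
        have g2 : 0 ≤ m * y := by positivity
        have g3 : 0 ≤ b ^ 2 := sq_nonneg _
        have g4 : 0 ≤ b * y := by positivity
        rw [hD]
        constructor <;> linarith [hLb.1, hLb.2]
      have hD2 : D ^ 2 ≤ 162 * b ^ 2 * y ^ 2 + 32 * b ^ 4 := by
        have : D ^ 2 ≤ (9 * b * y + 4 * b ^ 2) ^ 2 :=
          sq_le_sq' (neg_le_of_abs_le hDb) (le_of_abs_le hDb)
        nlinarith [sq_nonneg (9 * b * y - 4 * b ^ 2)]
      have e10 : N (next q a s) ^ 2 ≤ (N q + D) ^ 2 := pow_le_pow_left₀ (hN0 _) e9 2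
      have e11 : ∑ i, 4 * N q * ((q i : ℝ) - proj q i) * ((a i : ℝ) - arrivalMean (A i))
          = 4 * N q * L := by
        rw [hL, Finset.mul_sum _ _ (4 * N q)]
        exact Finset.sum_congr rfl fun i _ => mul_assoc _ _ _
      have e12 := cubic_drift_le (c := 2 * m) (B := B) (D := 32 * b ^ 4)
        (by positivity) (by positivity) hy0
      rw [e11]
      have e13 : (N q + D) ^ 2 = N q ^ 2 + 4 * N q * L - 2 * m * y ^ 3 + 8 * b ^ 2 * y ^ 2
          + D ^ 2 := by
        have : (N q + D) ^ 2 = N q ^ 2 + 2 * N q * D + D ^ 2 := by ring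
        rw [this, hD, ← hyN]
        ring
      rw [hB] at e12 ⊢
      linarith)
  have hint : Integrable (fun q : QVec => imbalance q ^ 2) π.toMeasure := by
    refine (h1.const_mul 4).mono' (Measurable.of_discrete).aestronglyMeasurable
      (Eventually.of_forall fun q => ?_)
    rw [Real.norm_of_nonneg (sq_nonneg _)]
    exact hdN q
  refine ⟨hint, ?_⟩
  refine (integral_mono hint (h1.const_mul 4) hdN).trans ?_
  rw [integral_const_mul]
  linarith

end Drift

/-! ### Stationary identities for normalized linear forms -/

/-- Unused service with respect to the completed schedule, as a function on the joint space. -/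
def idleOf (z : (QVec × QVec) × QVec) (i : Fin 4) : ℝ := idle z.1.1 z.2 z.1.2 i

/-- Mean queue lengths. -/
def queueMean (π : PMF QVec) (i : Fin 4) : ℝ := ∫ q, (q i : ℝ) ∂π.toMeasure

/-- Mean of the product of the new length of queue `i` and the unused service at queue `j`. -/
def crossMean (A : Fin 4 → PMF ℕ) (rule : QVec → PMF QVec) (π : PMF QVec) (i j : Fin 4) : ℝ :=
  ∫ z, (nextOf z i : ℝ) * idleOf z j ∂jointLaw A rule π

/-- Mean of the product of the unused services at the queues `i` and `j`. -/
def idleCrossMean (A : Fin 4 → PMF ℕ) (rule : QVec → PMF QVec) (π : PMF QVec) (i j : Fin 4) : ℝ :=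
  ∫ z, idleOf z i * idleOf z j ∂jointLaw A rule π

section Stationary

variable {A : Fin 4 → PMF ℕ} {Amax : ℕ} {rule : QVec → PMF QVec} {π : PMF QVec} {ν : Fin 4 → ℝ}
  {ε : ℝ}

theorem jointLaw_ae_good (hA : ∀ i, ∀ n ∈ (A i).support, n ≤ Amax) (hr : IsMaxWeightRule rule) :
    ∀ᵐ z ∂jointLaw A rule π, IsMaxWeight z.1.1 z.1.2 ∧ ∀ i, z.2 i ≤ Amax := by
  have h1 : ∀ᵐ z ∂jointLaw A rule π, IsMaxWeight z.1.1 z.1.2 :=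
    Measure.quasiMeasurePreserving_fst.ae (scheduleLaw_ae_maxWeight π hr)
  have h2 : ∀ᵐ z ∂jointLaw A rule π, ∀ i, z.2 i ≤ Amax :=
    Measure.quasiMeasurePreserving_snd.ae (arrivals_ae_le hA)
  exact h1.and h2

theorem integrable_queue {f : QVec → ℝ} (hf : Integrable f π.toMeasure) :
    Integrable (fun z => f z.1.1) (jointLaw A rule π) := by
  rw [← jointLaw_map_queue A rule π] at hf
  exact hf.comp_measurable Measurable.of_discrete

theorem integrable_next (hπ : IsSteadyState A rule π) {f : QVec → ℝ}
    (hf : Integrable f π.toMeasure) :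
    Integrable (fun z => f (nextOf z)) (jointLaw A rule π) := by
  rw [← jointLaw_map_next hπ] at hf
  exact hf.comp_measurable Measurable.of_discrete

theorem integral_queue (f : QVec → ℝ) :
    ∫ z, f z.1.1 ∂jointLaw A rule π = ∫ q, f q ∂π.toMeasure := by
  have hm : Measurable (fun z : (QVec × QVec) × QVec => z.1.1) := Measurable.of_discrete
  rw [← jointLaw_map_queue A rule π, integral_map hm.aemeasurable
    (Measurable.of_discrete).aestronglyMeasurable]

theorem integral_next (hπ : IsSteadyState A rule π) (f : QVec → ℝ) :
    ∫ z, f (nextOf z) ∂jointLaw A rule π = ∫ q, f q ∂π.toMeasure := by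
  have hm : Measurable nextOf := Measurable.of_discrete
  rw [← jointLaw_map_next hπ, integral_map hm.aemeasurable
    (Measurable.of_discrete).aestronglyMeasurable]

theorem integrable_mul_arrivals (hA : ∀ i, ∀ n ∈ (A i).support, n ≤ Amax) {f : QVec → ℝ}
    (hf : Integrable f π.toMeasure) (g : QVec → ℝ) :
    Integrable (fun z => f z.1.1 * g z.2) (jointLaw A rule π) := by
  have h : Integrable (fun z : QVec × QVec => f z.1) (scheduleLaw rule π).toMeasure := by
    rw [← scheduleLaw_map_fst rule π] at hf
    exact hf.comp_measurable measurable_fst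
  exact h.mul_prod (integrable_arrivals hA g)

theorem integral_mul_arrivals (f g : QVec → ℝ) :
    ∫ z, f z.1.1 * g z.2 ∂jointLaw A rule π
      = (∫ q, f q ∂π.toMeasure) * ∫ a, g a ∂(arrivals A).toMeasure := by
  unfold jointLaw
  rw [integral_prod_mul (fun z : QVec × QVec => f z.1) g, ← scheduleLaw_map_fst rule π,
    integral_map measurable_fst.aemeasurable (Measurable.of_discrete).aestronglyMeasurable]

theorem integrable_mul_idle (hA : ∀ i, ∀ n ∈ (A i).support, n ≤ Amax)
    (hr : IsMaxWeightRule rule) {f : (QVec × QVec) × QVec → ℝ}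
    (hf : Integrable f (jointLaw A rule π)) (j : Fin 4) :
    Integrable (fun z => f z * idleOf z j) (jointLaw A rule π) := by
  refine hf.mono (Measurable.of_discrete).aestronglyMeasurable ?_
  filter_upwards [jointLaw_ae_good hA hr] with z hz
  rw [norm_mul]
  refine mul_le_of_le_one_right (norm_nonneg _) ?_
  rw [idleOf, Real.norm_of_nonneg (idle_nonneg hz.1 _ _)]
  exact idle_le_one hz.1 _ _

theorem integrable_idle (hA : ∀ i, ∀ n ∈ (A i).support, n ≤ Amax)
    (hr : IsMaxWeightRule rule) (j : Fin 4) :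
    Integrable (fun z => idleOf z j) (jointLaw A rule π) := by
  simpa using integrable_mul_idle hA hr (integrable_const (1 : ℝ)) j

/-- A linear form which is equal to `1 / 2` at both maximal schedules. -/
def IsNormalized (c : Fin 4 → ℝ) : Prop := c 0 + c 3 = 1 / 2 ∧ c 1 + c 2 = 1 / 2

/-- Linear combinations of the queue lengths. -/
def queueForm (c : Fin 4 → ℝ) (q : QVec) : ℝ := ∑ i, c i * (q i : ℝ)

/-- Linear combinations of the unused services. -/
def idleForm (c : Fin 4 → ℝ) (z : (QVec × QVec) × QVec) : ℝ := ∑ i, c i * idleOf z i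

/-- Net arrivals for a normalized linear form. -/
def noise (A : Fin 4 → PMF ℕ) (ε : ℝ) (c : Fin 4 → ℝ) (a : QVec) : ℝ :=
  ∑ i, c i * ((a i : ℝ) - arrivalMean (A i)) - ε / 2

theorem integral_sum_centered (hA : ∀ i, ∀ n ∈ (A i).support, n ≤ Amax) (c : Fin 4 → ℝ) :
    ∫ a : QVec, ∑ i, c i * ((a i : ℝ) - arrivalMean (A i)) ∂(arrivals A).toMeasure = 0 := by
  rw [integral_finsetSum _ fun j _ => integrable_arrivals hA _]
  simp [integral_const_mul, integral_centered hA]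

theorem integral_noise (hA : ∀ i, ∀ n ∈ (A i).support, n ≤ Amax) (c : Fin 4 → ℝ) :
    ∫ a, noise A ε c a ∂(arrivals A).toMeasure = -(ε / 2) := by
  unfold noise
  rw [integral_sub (integrable_arrivals hA _) (integrable_const _), integral_sum_centered hA]
  simp

theorem integral_noise_mul (hA : ∀ i, ∀ n ∈ (A i).support, n ≤ Amax) (c c' : Fin 4 → ℝ) :
    ∫ a, noise A ε c a * noise A ε c' a ∂(arrivals A).toMeasure
      = ∑ i, c i * c' i * arrivalVar (A i) + ε ^ 2 / 4 := by
  have hi := integrable_arrivals (A := A) hA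
  have e : ∀ a : QVec, noise A ε c a * noise A ε c' a
      = ∑ i, ∑ j, c i * c' j * (((a i : ℝ) - arrivalMean (A i)) * ((a j : ℝ) - arrivalMean (A j)))
        - ε / 2 * (∑ i, c i * ((a i : ℝ) - arrivalMean (A i))
          + ∑ i, c' i * ((a i : ℝ) - arrivalMean (A i))) + ε ^ 2 / 4 := by
    intro a
    have h : ∑ i, ∑ j, c i * c' j *
        (((a i : ℝ) - arrivalMean (A i)) * ((a j : ℝ) - arrivalMean (A j)))
        = (∑ i, c i * ((a i : ℝ) - arrivalMean (A i)))
          * ∑ i, c' i * ((a i : ℝ) - arrivalMean (A i)) := by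
      rw [Finset.sum_mul_sum]
      exact Finset.sum_congr rfl fun i _ => Finset.sum_congr rfl fun j _ => by ring
    rw [h]
    unfold noise
    ring
  simp only [e]
  rw [integral_add (hi _) (hi _), integral_sub (hi _) (hi _), integral_const_mul,
    integral_add (hi _) (hi _), integral_sum_centered hA, integral_sum_centered hA,
    integral_finsetSum _ fun i _ => hi _]
  simp only [integral_finsetSum _ fun j _ => hi _, integral_const_mul, integral_centered_mul hA]
  simp

/-- Both matchings and `ν` have the value 1/2 under `c`, so the completed schedule drops out and the
mean net input is (1 - ε)/2 - 1/2 = -ε/2. -/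
theorem queueForm_next (hν : IsSaturated ν) (hmean : ∀ i, arrivalMean (A i) = (1 - ε) * ν i)
    {c : Fin 4 → ℝ} (hc : IsNormalized c) (z : (QVec × QVec) × QVec) :
    queueForm c (nextOf z) = queueForm c z.1.1 + noise A ε c z.2 + idleForm c z := by
  obtain ⟨h1, h2⟩ := hc
  obtain ⟨-, n1, n2, n3, n4⟩ := hν
  have f1 : ν 1 = 1 - ν 0 := by linarith
  have f2 : ν 2 = 1 - ν 0 := by linarith
  have f3 : ν 3 = ν 0 := by linarith
  have f4 : c 3 = 1 / 2 - c 0 := by linarith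
  have f5 : c 2 = 1 / 2 - c 1 := by linarith
  simp only [queueForm, noise, idleForm, nextOf, next_eq, hmean, idleOf, Fin.sum_univ_four,
    f1, f2, f3]
  rcases completion_eq z.1.2 with ⟨c0, c1, c2, c3⟩ | ⟨c0, c1, c2, c3⟩ <;>
    rw [c0, c1, c2, c3, f4, f5] <;> push_cast <;> ring

theorem integrable_queueForm (hq : ∀ i, Integrable (fun q : QVec => (q i : ℝ)) π.toMeasure)
    (c : Fin 4 → ℝ) : Integrable (queueForm c) π.toMeasure :=
  integrable_finsetSum _ fun j _ => (hq j).const_mul _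

theorem integral_queueForm (hq : ∀ i, Integrable (fun q : QVec => (q i : ℝ)) π.toMeasure)
    (c : Fin 4 → ℝ) : ∫ q, queueForm c q ∂π.toMeasure = ∑ i, c i * queueMean π i := by
  unfold queueForm queueMean
  rw [integral_finsetSum _ fun j _ => (hq j).const_mul _]
  simp only [integral_const_mul]

theorem integrable_idleForm (hA : ∀ i, ∀ n ∈ (A i).support, n ≤ Amax)
    (hr : IsMaxWeightRule rule) (c : Fin 4 → ℝ) :
    Integrable (idleForm c) (jointLaw A rule π) :=
  integrable_finsetSum _ fun j _ => (integrable_idle hA hr j).const_mul _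

theorem integrable_noise (hA : ∀ i, ∀ n ∈ (A i).support, n ≤ Amax) (c : Fin 4 → ℝ) :
    Integrable (fun z => noise A ε c z.2) (jointLaw A rule π) := by
  simpa using integrable_mul_arrivals (rule := rule) (π := π) hA (integrable_const (1 : ℝ))
    (noise A ε c)

theorem integral_snd (f : QVec → ℝ) :
    ∫ z, f z.2 ∂jointLaw A rule π = ∫ a, f a ∂(arrivals A).toMeasure := by
  simpa using integral_mul_arrivals (A := A) (rule := rule) (π := π) (fun _ => (1 : ℝ)) f

theorem idle_mean_nonneg (hA : ∀ i, ∀ n ∈ (A i).support, n ≤ Amax)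
    (hr : IsMaxWeightRule rule) (i : Fin 4) : 0 ≤ ∫ z, idleOf z i ∂jointLaw A rule π := by
  refine integral_nonneg_of_ae ?_
  filter_upwards [jointLaw_ae_good hA hr] with z hz using idle_nonneg hz.1 _ _

/-- With `c` constantly 1/4, stationarity of the mean of ⟨c, q⟩ forces the total mean idleness to be
exactly 2ε. -/
theorem idle_mean_le (hA : ∀ i, ∀ n ∈ (A i).support, n ≤ Amax)
    (hr : IsMaxWeightRule rule) (hπ : IsSteadyState A rule π) (hν : IsSaturated ν)
    (hmean : ∀ i, arrivalMean (A i) = (1 - ε) * ν i)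
    (hq : ∀ i, Integrable (fun q : QVec => (q i : ℝ)) π.toMeasure) (i : Fin 4) :
    ∫ z, idleOf z i ∂jointLaw A rule π ≤ 2 * ε := by
  have hU := fun j => integrable_idle (π := π) hA hr j
  set c : Fin 4 → ℝ := fun _ => 1 / 4 with hcdef
  have hc : IsNormalized c := by unfold IsNormalized; norm_num [hcdef]
  have hX := integrable_queueForm hq c
  have e := integral_next hπ (queueForm c)
  simp only [queueForm_next hν hmean hc] at e
  have h1 : Integrable (fun z => queueForm c z.1.1 + noise A ε c z.2) (jointLaw A rule π) :=
    (integrable_queue hX).add (integrable_noise hA c)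
  rw [integral_add h1 (integrable_idleForm hA hr c),
    integral_add (integrable_queue hX) (integrable_noise hA c), integral_queue,
    integral_snd (noise A ε c), integral_noise hA] at e
  have e2 : ∫ z, idleForm c z ∂jointLaw A rule π
      = ∑ j, c j * ∫ z, idleOf z j ∂jointLaw A rule π := by
    unfold idleForm
    rw [integral_finsetSum _ fun j _ => (hU j).const_mul _]
    simp only [integral_const_mul]
  rw [e2, ← Finset.mul_sum] at e
  have h3 := Finset.single_le_sum (f := fun j => ∫ z, idleOf z j ∂jointLaw A rule π)
    (fun j _ => idle_mean_nonneg (π := π) hA hr j) (Finset.mem_univ i)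
  linarith

theorem crossMean_nonneg (hA : ∀ i, ∀ n ∈ (A i).support, n ≤ Amax)
    (hr : IsMaxWeightRule rule) (i j : Fin 4) : 0 ≤ crossMean A rule π i j := by
  refine integral_nonneg_of_ae ?_
  filter_upwards [jointLaw_ae_good hA hr] with z hz
    using mul_nonneg (Nat.cast_nonneg _) (idle_nonneg hz.1 _ _)

theorem idleCrossMean_nonneg (hA : ∀ i, ∀ n ∈ (A i).support, n ≤ Amax)
    (hr : IsMaxWeightRule rule) (i j : Fin 4) : 0 ≤ idleCrossMean A rule π i j := by
  refine integral_nonneg_of_ae ?_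
  filter_upwards [jointLaw_ae_good hA hr] with z hz
    using mul_nonneg (idle_nonneg hz.1 _ _) (idle_nonneg hz.1 _ _)

theorem idleCrossMean_le (hA : ∀ i, ∀ n ∈ (A i).support, n ≤ Amax)
    (hr : IsMaxWeightRule rule) (hπ : IsSteadyState A rule π) (hν : IsSaturated ν)
    (hmean : ∀ i, arrivalMean (A i) = (1 - ε) * ν i)
    (hq : ∀ i, Integrable (fun q : QVec => (q i : ℝ)) π.toMeasure) (i j : Fin 4) :
    idleCrossMean A rule π i j ≤ 2 * ε := by
  refine le_trans ?_ (idle_mean_le hA hr hπ hν hmean hq i)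
  refine integral_mono_ae (integrable_mul_idle hA hr (integrable_idle hA hr i) j)
    (integrable_idle hA hr i) ?_
  filter_upwards [jointLaw_ae_good hA hr] with z hz
    using mul_le_of_le_one_right (idle_nonneg hz.1 _ _) (idle_le_one hz.1 _ _)

theorem crossMean_self_le (hA : ∀ i, ∀ n ∈ (A i).support, n ≤ Amax)
    (hr : IsMaxWeightRule rule) (hπ : IsSteadyState A rule π) (hν : IsSaturated ν)
    (hmean : ∀ i, arrivalMean (A i) = (1 - ε) * ν i)
    (hq : ∀ i, Integrable (fun q : QVec => (q i : ℝ)) π.toMeasure) (i : Fin 4) :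
    crossMean A rule π i i ≤ Amax * (2 * ε) := by
  refine le_trans ?_ (mul_le_mul_of_nonneg_left (idle_mean_le hA hr hπ hν hmean hq i)
    (Nat.cast_nonneg Amax))
  rw [← integral_const_mul]
  refine integral_mono_ae (integrable_mul_idle hA hr (integrable_next hπ (hq i)) i)
    ((integrable_idle hA hr i).const_mul _) ?_
  filter_upwards [jointLaw_ae_good hA hr] with z hz
  refine (next_mul_idle_le hz.1 _ _).trans ?_
  exact mul_le_mul_of_nonneg_right (by exact_mod_cast hz.2 i) (idle_nonneg hz.1 _ _)

/-- Vanishing of the drift of the product of two normalized linear forms. -/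
theorem drift_identity (hA : ∀ i, ∀ n ∈ (A i).support, n ≤ Amax)
    (hr : IsMaxWeightRule rule) (hπ : IsSteadyState A rule π) (hν : IsSaturated ν)
    (hmean : ∀ i, arrivalMean (A i) = (1 - ε) * ν i)
    (hq : ∀ i, Integrable (fun q : QVec => (q i : ℝ)) π.toMeasure)
    {c c' : Fin 4 → ℝ} (hc : IsNormalized c) (hc' : IsNormalized c') :
    ε * ∑ i, (c i + c' i) * queueMean π i
      = 2 * ∑ i, ∑ j, (c i * c' j + c' i * c j) * crossMean A rule π i j
        - 2 * ∑ i, ∑ j, c i * c' j * idleCrossMean A rule π i j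
        + 2 * ∑ i, c i * c' i * arrivalVar (A i) + ε ^ 2 / 2 := by
  set P := jointLaw A rule π with hP
  have hW : ∀ i j, Integrable (fun z => (nextOf z i : ℝ) * idleOf z j) P := fun i j =>
    integrable_mul_idle hA hr (integrable_next hπ (hq i)) j
  have hZ : ∀ i j, Integrable (fun z => idleOf z i * idleOf z j) P := fun i j =>
    integrable_mul_idle hA hr (integrable_idle hA hr i) j
  have hcross : ∀ c c' : Fin 4 → ℝ,
      Integrable (fun z => queueForm c (nextOf z) * idleForm c' z) P ∧
      ∫ z, queueForm c (nextOf z) * idleForm c' z ∂P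
        = ∑ i, ∑ j, c i * c' j * crossMean A rule π i j := by
    intro c c'
    have e : ∀ z, queueForm c (nextOf z) * idleForm c' z
        = ∑ i, ∑ j, c i * c' j * ((nextOf z i : ℝ) * idleOf z j) := fun z => by
      unfold queueForm idleForm
      rw [Finset.sum_mul_sum]
      exact Finset.sum_congr rfl fun i _ => Finset.sum_congr rfl fun j _ => by ring
    simp only [e]
    refine ⟨integrable_finsetSum _ fun i _ => integrable_finsetSum _ fun j _ =>
      (hW i j).const_mul _, ?_⟩
    rw [integral_finsetSum _ fun i _ => integrable_finsetSum _ fun j _ => (hW i j).const_mul _]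
    refine Finset.sum_congr rfl fun i _ => ?_
    rw [integral_finsetSum _ fun j _ => (hW i j).const_mul _]
    simp only [integral_const_mul]
    rfl
  have hidle : Integrable (fun z => idleForm c z * idleForm c' z) P ∧
      ∫ z, idleForm c z * idleForm c' z ∂P
        = ∑ i, ∑ j, c i * c' j * idleCrossMean A rule π i j := by
    have e : ∀ z, idleForm c z * idleForm c' z
        = ∑ i, ∑ j, c i * c' j * (idleOf z i * idleOf z j) := fun z => by
      unfold idleForm
      rw [Finset.sum_mul_sum]
      exact Finset.sum_congr rfl fun i _ => Finset.sum_congr rfl fun j _ => by ring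
    simp only [e]
    refine ⟨integrable_finsetSum _ fun i _ => integrable_finsetSum _ fun j _ =>
      (hZ i j).const_mul _, ?_⟩
    rw [integral_finsetSum _ fun i _ => integrable_finsetSum _ fun j _ => (hZ i j).const_mul _]
    refine Finset.sum_congr rfl fun i _ => ?_
    rw [integral_finsetSum _ fun j _ => (hZ i j).const_mul _]
    simp only [integral_const_mul]
    rfl
  have hXB : ∀ c c' : Fin 4 → ℝ,
      Integrable (fun z => queueForm c z.1.1 * noise A ε c' z.2) P ∧
      ∫ z, queueForm c z.1.1 * noise A ε c' z.2 ∂P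
        = (∑ i, c i * queueMean π i) * (-(ε / 2)) := by
    intro c c'
    refine ⟨integrable_mul_arrivals hA (integrable_queueForm hq c) _, ?_⟩
    rw [integral_mul_arrivals, integral_noise hA, integral_queueForm hq]
  have hBB : Integrable (fun z => noise A ε c z.2 * noise A ε c' z.2) P ∧
      ∫ z, noise A ε c z.2 * noise A ε c' z.2 ∂P
        = ∑ i, c i * c' i * arrivalVar (A i) + ε ^ 2 / 4 := by
    constructor
    · simpa using integrable_mul_arrivals (rule := rule) (π := π) hA (integrable_const (1 : ℝ))
        fun a => noise A ε c a * noise A ε c' a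
    · rw [integral_snd fun a => noise A ε c a * noise A ε c' a, integral_noise_mul hA]
  -- Idle terms are paired with the new queue lengths, which leaves the correction `-idleForm c z *
  -- idleForm c' z`. The right side needs only first moments of the queues, so the mean of the
  -- difference is zero without second moments.
  have e : ∀ z, queueForm c (nextOf z) * queueForm c' (nextOf z)
      - queueForm c z.1.1 * queueForm c' z.1.1
      = queueForm c (nextOf z) * idleForm c' z + queueForm c' (nextOf z) * idleForm c z
        - idleForm c z * idleForm c' z + queueForm c z.1.1 * noise A ε c' z.2
        + queueForm c' z.1.1 * noise A ε c z.2 + noise A ε c z.2 * noise A ε c' z.2 := by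
    intro z
    rw [queueForm_next hν hmean hc, queueForm_next hν hmean hc']
    ring
  have i1 : Integrable (fun z => queueForm c (nextOf z) * idleForm c' z
      + queueForm c' (nextOf z) * idleForm c z) P := (hcross c c').1.add (hcross c' c).1
  have i2 : Integrable (fun z => queueForm c (nextOf z) * idleForm c' z
      + queueForm c' (nextOf z) * idleForm c z - idleForm c z * idleForm c' z) P := i1.sub hidle.1
  have i3 : Integrable (fun z => queueForm c (nextOf z) * idleForm c' z
      + queueForm c' (nextOf z) * idleForm c z - idleForm c z * idleForm c' z
      + queueForm c z.1.1 * noise A ε c' z.2) P := i2.add (hXB c c').1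
  have i4 : Integrable (fun z => queueForm c (nextOf z) * idleForm c' z
      + queueForm c' (nextOf z) * idleForm c z - idleForm c z * idleForm c' z
      + queueForm c z.1.1 * noise A ε c' z.2 + queueForm c' z.1.1 * noise A ε c z.2) P :=
    i3.add (hXB c' c).1
  have h0 := integral_sub_eq_zero_of_map_eq (P := P)
    (X := fun z => queueForm c (nextOf z) * queueForm c' (nextOf z))
    (Y := fun z => queueForm c z.1.1 * queueForm c' z.1.1)
    Measurable.of_discrete Measurable.of_discrete (by
      have m1 : Measurable fun q : QVec => queueForm c q * queueForm c' q := Measurable.of_discrete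
      have m2 : Measurable nextOf := Measurable.of_discrete
      have m3 : Measurable fun z : (QVec × QVec) × QVec => z.1.1 := Measurable.of_discrete
      have := congrArg (Measure.map fun q => queueForm c q * queueForm c' q)
        ((jointLaw_map_next hπ).trans (jointLaw_map_queue A rule π).symm)
      rw [Measure.map_map m1 m2, Measure.map_map m1 m3] at this
      exact this) (by
      simp only [e]
      exact i4.add hBB.1)
  simp only [e] at h0
  rw [integral_add i4 hBB.1, integral_add i3 (hXB c' c).1, integral_add i2 (hXB c c').1,
    integral_sub i1 hidle.1, integral_add (hcross c c').1 (hcross c' c).1, (hcross c c').2,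
    (hcross c' c).2, hidle.2, (hXB c c').2, (hXB c' c).2, hBB.2] at h0
  simp only [add_mul, Finset.sum_add_distrib]
  linarith

/-- For u in {0, 1}, |x| u ≤ √ε x² + u / √ε. The second moment of the imbalance controls the first
term and E u ≤ 2ε the second, so both are of order √ε when that moment is bounded. -/
theorem abs_imbalance_idle_le (hA : ∀ i, ∀ n ∈ (A i).support, n ≤ Amax)
    (hr : IsMaxWeightRule rule) (hπ : IsSteadyState A rule π) (hν : IsSaturated ν)
    (hmean : ∀ i, arrivalMean (A i) = (1 - ε) * ν i) (hε : 0 < ε)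
    (hq : ∀ i, Integrable (fun q : QVec => (q i : ℝ)) π.toMeasure)
    (hd : Integrable (fun q => imbalance q ^ 2) π.toMeasure) (j : Fin 4) :
    |crossMean A rule π 0 j + crossMean A rule π 3 j - crossMean A rule π 1 j
      - crossMean A rule π 2 j| ≤ √ε * (∫ q, imbalance q ^ 2 ∂π.toMeasure + 2) := by
  set P := jointLaw A rule π with hP
  have hW : ∀ i j, Integrable (fun z => (nextOf z i : ℝ) * idleOf z j) P := fun i j =>
    integrable_mul_idle hA hr (integrable_next hπ (hq i)) j
  have hs : 0 < √ε := Real.sqrt_pos.2 hε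
  have e : crossMean A rule π 0 j + crossMean A rule π 3 j - crossMean A rule π 1 j
      - crossMean A rule π 2 j = ∫ z, imbalance (nextOf z) * idleOf z j ∂P := by
    unfold crossMean
    rw [← integral_add (hW 0 j) (hW 3 j), ← integral_sub _ (hW 1 j), ← integral_sub _ (hW 2 j)]
    · refine integral_congr_ae (Eventually.of_forall fun z => ?_)
      simp only [imbalance]
      ring
    · exact ((hW 0 j).add (hW 3 j)).sub (hW 1 j)
    · exact (hW 0 j).add (hW 3 j)
  have hd' := integrable_next hπ hd
  have hU := integrable_idle (π := π) hA hr j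
  rw [e]
  refine (abs_integral_le_integral_abs).trans ?_
  have hb : ∫ z, |imbalance (nextOf z) * idleOf z j| ∂P
      ≤ ∫ z, (√ε * imbalance (nextOf z) ^ 2 + (√ε)⁻¹ * idleOf z j) ∂P := by
    refine integral_mono_of_nonneg (Eventually.of_forall fun z => abs_nonneg _)
      ((hd'.const_mul _).add (hU.const_mul _)) ?_
    filter_upwards [jointLaw_ae_good hA hr] with z hz
    set x := imbalance (nextOf z)
    rcases idle_cases hz.1 z.2 j with h | ⟨h, -⟩ <;> simp only [idleOf, h]
    · simp only [mul_zero, abs_zero]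
      positivity
    · rw [mul_one, mul_one]
      have h1 : √ε * (√ε)⁻¹ = 1 := mul_inv_cancel₀ hs.ne'
      have h2 : 0 ≤ (√ε)⁻¹ := inv_nonneg.2 hs.le
      rw [← sq_abs x]
      nlinarith [mul_nonneg h2 (sq_nonneg (√ε * |x| - 1)), abs_nonneg x]
  refine hb.trans ?_
  rw [integral_add (hd'.const_mul _) (hU.const_mul _), integral_const_mul, integral_const_mul,
    integral_next hπ fun q => imbalance q ^ 2]
  have h1 := idle_mean_le hA hr hπ hν hmean hq j
  have h2 : (√ε)⁻¹ * ∫ z, idleOf z j ∂P ≤ (√ε)⁻¹ * (2 * ε) :=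
    mul_le_mul_of_nonneg_left h1 (inv_nonneg.2 hs.le)
  have h3 : (√ε)⁻¹ * (2 * ε) = 2 * √ε := by
    field_simp
    rw [Real.sq_sqrt hε.le]
  linarith

end Stationary

/-! ### Compactness of the linear program -/

theorem isClosed_polytope (σ : Fin 4 → ℝ) : IsClosed (polytope σ) := by
  have h1 : IsClosed {x : (Fin 3 → ℝ) × (Fin 8 → ℝ) | ∀ i, 0 ≤ x.1 i} := by
    simp only [Set.ofPred_forall]
    exact isClosed_iInter fun i => isClosed_le (by fun_prop) (by fun_prop)
  have h2 : IsClosed {x : (Fin 3 → ℝ) × (Fin 8 → ℝ) | ∀ i, 0 ≤ x.2 i} := by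
    simp only [Set.ofPred_forall]
    exact isClosed_iInter fun i => isClosed_le (by fun_prop) (by fun_prop)
  refine h1.inter (h2.inter ?_)
  refine (isClosed_eq (by fun_prop) (by fun_prop)).inter ?_
  refine (isClosed_eq (by fun_prop) (by fun_prop)).inter ?_
  refine (isClosed_eq (by fun_prop) (by fun_prop)).inter ?_
  refine (isClosed_eq (by fun_prop) (by fun_prop)).inter ?_
  refine (isClosed_eq (by fun_prop) (by fun_prop)).inter ?_
  refine (isClosed_eq (by fun_prop) (by fun_prop)).inter ?_
  have h3 : ∀ g : (Fin 3 → ℝ) × (Fin 8 → ℝ) → ℝ, Continuous g → IsClosed {x | 0 ≤ g x} :=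
    fun g hg => isClosed_le continuous_const hg
  exact (h3 (fun x => -x.1 0 + x.1 1 + x.1 2) (by fun_prop)).inter
    ((h3 (fun x => -x.2 0 + x.2 6) (by fun_prop)).inter
      (h3 (fun x => -x.2 1 + x.2 3) (by fun_prop)))

theorem isCompact_polytope (σ : Fin 4 → ℝ) : IsCompact (polytope σ) := by
  set S : ℝ := σ 0 ^ 2 + σ 1 ^ 2 + σ 2 ^ 2 + σ 3 ^ 2 with hS
  refine (isCompact_Icc (a := (0 : (Fin 3 → ℝ) × (Fin 8 → ℝ)))
    (b := (fun _ => 100 * S, fun _ => 1000 * S))).of_isClosed_subset (isClosed_polytope σ) ?_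
  rintro ⟨v, w⟩ ⟨hv, hw, e1, e2, e3, e4, e5, e6, h7, h8, h9⟩
  have s0 := sq_nonneg (σ 0)
  have s1 := sq_nonneg (σ 1)
  have s2 := sq_nonneg (σ 2)
  have s3 := sq_nonneg (σ 3)
  have v0 := hv 0
  have v1 := hv 1
  have v2 := hv 2
  have w2 := hw 2
  have w3 := hw 3
  have w4 := hw 4
  have w5 := hw 5
  have w6 := hw 6
  have w7 := hw 7
  -- Subtracting `e6` from `e2 + e3` gives `w 3 + w 6 = (σ 1 ^ 2 + σ 2 ^ 2) / 2`. Then `h8` and `h9`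
  -- bound `w 0` and `w 1`, `e1` bounds `v 0`, `w 4` and `w 7`, and `e4 - e2` and `e5 - e3` bound `w
  -- 2` and `w 5`.
  have hv12 : v 1 + v 2 ≤ 10 * S := by rw [hS]; linarith
  have hw27 : w 2 + w 3 + w 4 + w 5 + w 6 + w 7 ≤ 100 * S := by rw [hS] at hv12 ⊢; linarith
  refine ⟨⟨hv, hw⟩, fun i => ?_, fun i => ?_⟩
  · fin_cases i <;> simp <;> linarith
  · fin_cases i <;> simp <;> linarith

theorem values_eq_image (σ : Fin 4 → ℝ) (α : Fin 3 → ℝ) :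
    values σ α = (fun x : (Fin 3 → ℝ) × (Fin 8 → ℝ) =>
      α 0 * x.1 0 + α 1 * x.1 1 + α 2 * x.1 2) '' polytope σ := by
  ext x
  constructor
  · rintro ⟨v, w, h, rfl⟩
    exact ⟨(v, w), h, rfl⟩
  · rintro ⟨⟨v, w⟩, h, rfl⟩
    exact ⟨v, w, h, rfl⟩

theorem isCompact_values (σ : Fin 4 → ℝ) (α : Fin 3 → ℝ) : IsCompact (values σ α) := by
  rw [values_eq_image]
  exact (isCompact_polytope σ).image (by fun_prop)

/-- Along an ultrafilter the four scaled means and sixteen cross means converge simultaneously, with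
no extraction of successive subsequences. -/
theorem exists_tendsto_ultrafilter_of_bounded {f : ℝ → ℝ} {C : ℝ} (U : Ultrafilter ℝ)
    (h : ∀ᶠ ε in (U : Filter ℝ), 0 ≤ f ε ∧ f ε ≤ C) :
    ∃ x, 0 ≤ x ∧ Tendsto f U (𝓝 x) := by
  obtain ⟨x, hx, hle⟩ := (isCompact_Icc (a := (0 : ℝ)) (b := C)).ultrafilter_le_nhds (U.map f)
    (le_principal_iff.2 h)
  exact ⟨x, hx.1, hle⟩

/-! ### Heavy-traffic limits -/

section Family

variable {ν : Fin 4 → ℝ} {Amax : ℕ} {A : ℝ → Fin 4 → PMF ℕ} {rule : ℝ → QVec → PMF QVec}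
  {π : ℝ → PMF QVec}

theorem IsSaturated.exists_le {ν : Fin 4 → ℝ} (hν : IsSaturated ν) :
    ∃ m, 0 < m ∧ ∀ i, m ≤ ν i := by
  obtain ⟨i, -, hi⟩ := Finset.exists_min_image Finset.univ ν Finset.univ_nonempty
  exact ⟨ν i, hν.1 i, fun j => hi j (Finset.mem_univ j)⟩

theorem eventually_mem_Ioo : ∀ᶠ ε : ℝ in 𝓝[>] 0, ε ∈ Set.Ioo (0 : ℝ) 1 :=
  Ioo_mem_nhdsGT zero_lt_one

theorem IsHeavyTrafficFamily.integrable_queue (h : IsHeavyTrafficFamily ν Amax A rule π)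
    {ε : ℝ} (hε : ε ∈ Set.Ioo (0 : ℝ) 1) (i : Fin 4) :
    Integrable (fun q : QVec => (q i : ℝ)) (π ε).toMeasure := by
  obtain ⟨m, hm, hmν⟩ := h.saturated.exists_le
  have := (scaled_sum_mean_le (h.arrival_le ε hε) (h.maxWeight ε hε) (h.steady ε hε) h.saturated
    (h.arrival_mean ε hε) hε.1 hm hmν).1
  refine this.mono' (Measurable.of_discrete).aestronglyMeasurable (Eventually.of_forall fun q => ?_)
  rw [Real.norm_of_nonneg (Nat.cast_nonneg _)]
  exact Finset.single_le_sum (f := fun i => (q i : ℝ)) (fun i _ => Nat.cast_nonneg _)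
    (Finset.mem_univ i)

theorem IsHeavyTrafficFamily.exists_scaled_sum_le (h : IsHeavyTrafficFamily ν Amax A rule π) :
    ∃ C, ∀ ε ∈ Set.Ioo (0 : ℝ) 1, ∑ i, ε * queueMean (π ε) i ≤ C := by
  obtain ⟨m, hm, hmν⟩ := h.saturated.exists_le
  refine ⟨4 * ((Amax : ℝ) + 1) ^ 2 / (2 * m), fun ε hε => ?_⟩
  have := (scaled_sum_mean_le (h.arrival_le ε hε) (h.maxWeight ε hε) (h.steady ε hε) h.saturated
    (h.arrival_mean ε hε) hε.1 hm hmν).2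
  rw [integral_finsetSum _ fun i _ => h.integrable_queue hε i, Finset.mul_sum] at this
  exact this

theorem queueMean_nonneg (p : PMF QVec) (i : Fin 4) : 0 ≤ queueMean p i :=
  integral_nonneg fun _ => Nat.cast_nonneg _

theorem IsHeavyTrafficFamily.exists_imbalance_sq_le (h : IsHeavyTrafficFamily ν Amax A rule π) :
    ∃ C, ∀ᶠ ε in 𝓝[>] (0 : ℝ), Integrable (fun q => imbalance q ^ 2) (π ε).toMeasure ∧
      ∫ q, imbalance q ^ 2 ∂(π ε).toMeasure ≤ C := by
  obtain ⟨m, hm, hmν⟩ := h.saturated.exists_le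
  set b : ℝ := Amax + 1 with hb
  refine ⟨4 * ((170 * b ^ 2 + 1) * ((170 * b ^ 2 + 1) / (2 * m)) ^ 2 + 32 * b ^ 4), ?_⟩
  filter_upwards [eventually_mem_Ioo, Ioc_mem_nhdsGT (show (0 : ℝ) < m / 4 by positivity)]
    with ε hε hεm
  exact imbalance_sq_mean_le (h.arrival_le ε hε) (h.maxWeight ε hε) (h.steady ε hε) h.saturated
    (h.arrival_mean ε hε) hε.1 hε.2 hm hmν hεm.2 hb

theorem tendsto_zero_of_abs_le {f g : ℝ → ℝ} {l : Filter ℝ} (hg : Tendsto g l (𝓝 0))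
    (h : ∀ᶠ ε in l, |f ε| ≤ g ε) : Tendsto f l (𝓝 0) :=
  squeeze_zero_norm' (by simpa using h) hg

theorem tendsto_id_nhdsGT : Tendsto (fun ε : ℝ => ε) (𝓝[>] 0) (𝓝 0) :=
  tendsto_id.mono_left nhdsWithin_le_nhds

theorem IsHeavyTrafficFamily.tendsto_idleCrossMean (h : IsHeavyTrafficFamily ν Amax A rule π)
    (i j : Fin 4) :
    Tendsto (fun ε => idleCrossMean (A ε) (rule ε) (π ε) i j) (𝓝[>] 0) (𝓝 0) := by
  refine tendsto_zero_of_abs_le (g := fun ε => 2 * ε)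
    (by simpa using tendsto_id_nhdsGT.const_mul 2) ?_
  filter_upwards [eventually_mem_Ioo] with ε hε
  rw [abs_of_nonneg (idleCrossMean_nonneg (h.arrival_le ε hε) (h.maxWeight ε hε) i j)]
  exact idleCrossMean_le (h.arrival_le ε hε) (h.maxWeight ε hε) (h.steady ε hε) h.saturated
    (h.arrival_mean ε hε) (h.integrable_queue hε) i j

theorem IsHeavyTrafficFamily.tendsto_crossMean_self (h : IsHeavyTrafficFamily ν Amax A rule π)
    (i : Fin 4) :
    Tendsto (fun ε => crossMean (A ε) (rule ε) (π ε) i i) (𝓝[>] 0) (𝓝 0) := by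
  refine tendsto_zero_of_abs_le (g := fun ε => Amax * (2 * ε))
    (by simpa using (tendsto_id_nhdsGT.const_mul 2).const_mul (Amax : ℝ)) ?_
  filter_upwards [eventually_mem_Ioo] with ε hε
  rw [abs_of_nonneg (crossMean_nonneg (h.arrival_le ε hε) (h.maxWeight ε hε) i i)]
  exact crossMean_self_le (h.arrival_le ε hε) (h.maxWeight ε hε) (h.steady ε hε) h.saturated
    (h.arrival_mean ε hε) (h.integrable_queue hε) i

theorem IsHeavyTrafficFamily.tendsto_imbalance_idle (h : IsHeavyTrafficFamily ν Amax A rule π)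
    (j : Fin 4) :
    Tendsto (fun ε => crossMean (A ε) (rule ε) (π ε) 0 j + crossMean (A ε) (rule ε) (π ε) 3 j
      - crossMean (A ε) (rule ε) (π ε) 1 j - crossMean (A ε) (rule ε) (π ε) 2 j)
      (𝓝[>] 0) (𝓝 0) := by
  obtain ⟨C, hC⟩ := h.exists_imbalance_sq_le
  have hs : Tendsto (fun ε : ℝ => √ε * (C + 2)) (𝓝[>] 0) (𝓝 0) := by
    have : Tendsto (fun ε : ℝ => √ε * (C + 2)) (𝓝 0) (𝓝 (√0 * (C + 2))) :=
      (Real.continuous_sqrt.tendsto 0).mul_const _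
    simp only [Real.sqrt_zero, zero_mul] at this
    exact this.mono_left nhdsWithin_le_nhds
  refine tendsto_zero_of_abs_le hs ?_
  filter_upwards [eventually_mem_Ioo, hC] with ε hε hCε
  refine (abs_imbalance_idle_le (h.arrival_le ε hε) (h.maxWeight ε hε) (h.steady ε hε) h.saturated
    (h.arrival_mean ε hε) hε.1 (h.integrable_queue hε) hCε.1 j).trans ?_
  exact mul_le_mul_of_nonneg_left (by linarith [hCε.2]) (Real.sqrt_nonneg _)

theorem IsHeavyTrafficFamily.tendsto_scaled_imbalance (h : IsHeavyTrafficFamily ν Amax A rule π) :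
    Tendsto (fun ε => ε * queueMean (π ε) 0 + ε * queueMean (π ε) 3 - ε * queueMean (π ε) 1
      - ε * queueMean (π ε) 2) (𝓝[>] 0) (𝓝 0) := by
  obtain ⟨C, hC⟩ := h.exists_imbalance_sq_le
  refine tendsto_zero_of_abs_le (g := fun ε => ε * (1 + C))
    (by simpa using tendsto_id_nhdsGT.mul_const (1 + C)) ?_
  filter_upwards [eventually_mem_Ioo, hC] with ε hε hCε
  have hq := h.integrable_queue hε
  have e : ε * queueMean (π ε) 0 + ε * queueMean (π ε) 3 - ε * queueMean (π ε) 1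
      - ε * queueMean (π ε) 2 = ε * ∫ q, imbalance q ∂(π ε).toMeasure := by
    unfold imbalance queueMean
    rw [integral_sub _ (hq 2), integral_sub _ (hq 1), integral_add (hq 0) (hq 3)]
    · ring
    · exact (hq 0).add (hq 3)
    · exact ((hq 0).add (hq 3)).sub (hq 1)
  rw [e, abs_mul, abs_of_pos hε.1]
  refine mul_le_mul_of_nonneg_left (abs_integral_le_integral_abs.trans ?_) hε.1.le
  have hle : ∫ q, |imbalance q| ∂(π ε).toMeasure
      ≤ ∫ q, (1 + imbalance q ^ 2) ∂(π ε).toMeasure := by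
    refine integral_mono_of_nonneg (Eventually.of_forall fun z => abs_nonneg _)
      ((integrable_const _).add hCε.1) (Eventually.of_forall fun q => ?_)
    simp only
    rw [← sq_abs]
    nlinarith [sq_nonneg (|imbalance q| - 1), abs_nonneg (imbalance q)]
  refine hle.trans ?_
  rw [integral_add (integrable_const _) hCε.1]
  simp
  exact hCε.2

/-- In `drift_identity` with both forms constantly 1/4, every cross mean has a positive coefficient
and is nonnegative, so the scaled total queue length bounds each of them. -/
theorem IsHeavyTrafficFamily.exists_crossMean_le (h : IsHeavyTrafficFamily ν Amax A rule π) :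
    ∃ C, ∀ ε ∈ Set.Ioo (0 : ℝ) 1, ∀ i j, crossMean (A ε) (rule ε) (π ε) i j ≤ C := by
  obtain ⟨C, hC⟩ := h.exists_scaled_sum_le
  refine ⟨2 * C + 16, fun ε hε i j => ?_⟩
  have hc : IsNormalized fun _ => (1 / 4 : ℝ) := by unfold IsNormalized; norm_num
  have e := drift_identity (h.arrival_le ε hε) (h.maxWeight ε hε) (h.steady ε hε) h.saturated
    (h.arrival_mean ε hε) (h.integrable_queue hε) hc hc
  have hsum : ε * ∑ i, ((1 / 4 : ℝ) + 1 / 4) * queueMean (π ε) i ≤ C / 2 := by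
    have := hC ε hε
    rw [← Finset.mul_sum] at this ⊢
    linarith
  have hZ : ∑ i, ∑ j, (1 / 4 : ℝ) * (1 / 4) * idleCrossMean (A ε) (rule ε) (π ε) i j
      ≤ ∑ _i : Fin 4, ∑ _j : Fin 4, (1 / 4 : ℝ) * (1 / 4) * (2 * 1) := by
    refine Finset.sum_le_sum fun i _ => Finset.sum_le_sum fun j _ =>
      mul_le_mul_of_nonneg_left ?_ (by norm_num)
    refine (idleCrossMean_le (h.arrival_le ε hε) (h.maxWeight ε hε) (h.steady ε hε) h.saturated
      (h.arrival_mean ε hε) (h.integrable_queue hε) i j).trans ?_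
    linarith [hε.2]
  have hv : 0 ≤ ∑ i, (1 / 4 : ℝ) * (1 / 4) * arrivalVar (A ε i) :=
    Finset.sum_nonneg fun i _ => mul_nonneg (by norm_num) (arrivalVar_nonneg _)
  have hW0 := crossMean_nonneg (π := π ε) (h.arrival_le ε hε) (h.maxWeight ε hε)
  have hW : (1 / 4 * (1 / 4) + 1 / 4 * (1 / 4) : ℝ) * crossMean (A ε) (rule ε) (π ε) i j
      ≤ ∑ i, ∑ j, (1 / 4 * (1 / 4) + 1 / 4 * (1 / 4) : ℝ) * crossMean (A ε) (rule ε) (π ε) i j := by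
    have hnn : ∀ i j, 0 ≤ (1 / 4 * (1 / 4) + 1 / 4 * (1 / 4) : ℝ)
        * crossMean (A ε) (rule ε) (π ε) i j := fun i j => mul_nonneg (by norm_num) (hW0 i j)
    exact (Finset.single_le_sum (f := fun j => (1 / 4 * (1 / 4) + 1 / 4 * (1 / 4) : ℝ)
      * crossMean (A ε) (rule ε) (π ε) i j) (fun j _ => hnn i j) (Finset.mem_univ j)).trans
      (Finset.single_le_sum (f := fun i => ∑ j, (1 / 4 * (1 / 4) + 1 / 4 * (1 / 4) : ℝ)
      * crossMean (A ε) (rule ε) (π ε) i j) (fun i _ => Finset.sum_nonneg fun j _ => hnn i j)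
      (Finset.mem_univ i))
  simp only [Finset.sum_const, Finset.card_univ, Fintype.card_fin] at hZ
  norm_num at hZ
  have hε2 := sq_nonneg ε
  linarith

/-- Every cluster point of the scaled means lies in the polytope. -/
theorem IsHeavyTrafficFamily.exists_mem_polytope (h : IsHeavyTrafficFamily ν Amax A rule π)
    {σ : Fin 4 → ℝ}
    (hσ : ∀ i, Tendsto (fun ε => arrivalVar (A ε i)) (𝓝[>] 0) (𝓝 (σ i ^ 2)))
    (U : Ultrafilter ℝ) (hU : (U : Filter ℝ) ≤ 𝓝[>] 0) :
    ∃ v w, (v, w) ∈ polytope σ ∧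
      Tendsto (fun ε => ε * queueMean (π ε) 0) U (𝓝 (v 0)) ∧
      Tendsto (fun ε => ε * queueMean (π ε) 1) U (𝓝 (v 1)) ∧
      Tendsto (fun ε => ε * queueMean (π ε) 2) U (𝓝 (v 2)) := by
  have hIoo := hU eventually_mem_Ioo
  obtain ⟨C, hC⟩ := h.exists_scaled_sum_le
  obtain ⟨C', hC'⟩ := h.exists_crossMean_le
  have hV : ∀ i, ∃ x, 0 ≤ x ∧ Tendsto (fun ε => ε * queueMean (π ε) i) U (𝓝 x) := fun i => by
    refine exists_tendsto_ultrafilter_of_bounded (C := C) U ?_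
    filter_upwards [hIoo] with ε hε
    have hnn : ∀ i, 0 ≤ ε * queueMean (π ε) i := fun i =>
      mul_nonneg hε.1.le (queueMean_nonneg _ i)
    exact ⟨hnn i, (Finset.single_le_sum (f := fun i => ε * queueMean (π ε) i)
      (fun i _ => hnn i) (Finset.mem_univ i)).trans (hC ε hε)⟩
  have hW : ∀ i j, ∃ x, 0 ≤ x ∧
      Tendsto (fun ε => crossMean (A ε) (rule ε) (π ε) i j) U (𝓝 x) := fun i j => by
    refine exists_tendsto_ultrafilter_of_bounded (C := C') U ?_
    filter_upwards [hIoo] with ε hε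
    exact ⟨crossMean_nonneg (h.arrival_le ε hε) (h.maxWeight ε hε) i j, hC' ε hε i j⟩
  choose V hV0 hVlim using hV
  choose W hW0 hWlim using hW
  have hid : ∀ c c' : Fin 4 → ℝ, IsNormalized c → IsNormalized c' →
      ∑ i, (c i + c' i) * V i
        = 2 * ∑ i, ∑ j, (c i * c' j + c' i * c j) * W i j + 2 * ∑ i, c i * c' i * σ i ^ 2 := by
    intro c c' hc hc'
    have l1 : Tendsto (fun ε => ∑ i, (c i + c' i) * (ε * queueMean (π ε) i)) U
        (𝓝 (∑ i, (c i + c' i) * V i)) := tendsto_finsetSum _ fun i _ => (hVlim i).const_mul _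
    have l2 : Tendsto (fun ε => 2 * ∑ i, ∑ j, (c i * c' j + c' i * c j)
          * crossMean (A ε) (rule ε) (π ε) i j
        - 2 * ∑ i, ∑ j, c i * c' j * idleCrossMean (A ε) (rule ε) (π ε) i j
        + 2 * ∑ i, c i * c' i * arrivalVar (A ε i) + ε ^ 2 / 2) U
        (𝓝 (2 * ∑ i, ∑ j, (c i * c' j + c' i * c j) * W i j
        - 2 * ∑ i : Fin 4, ∑ j : Fin 4, c i * c' j * 0
        + 2 * ∑ i, c i * c' i * σ i ^ 2 + 0 ^ 2 / 2)) := by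
      refine (((Tendsto.const_mul _ ?_).sub (Tendsto.const_mul _ ?_)).add
        (Tendsto.const_mul _ ?_)).add (((tendsto_id_nhdsGT.mono_left hU).pow 2).div_const 2)
      · exact tendsto_finsetSum _ fun i _ => tendsto_finsetSum _ fun j _ => (hWlim i j).const_mul _
      · exact tendsto_finsetSum _ fun i _ => tendsto_finsetSum _ fun j _ =>
          ((h.tendsto_idleCrossMean i j).mono_left hU).const_mul _
      · exact tendsto_finsetSum _ fun i _ => ((hσ i).mono_left hU).const_mul _
    have e := tendsto_nhds_unique (l1.congr' ?_) l2
    · rw [e]; simp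
    · filter_upwards [hIoo] with ε hε
      rw [← drift_identity (h.arrival_le ε hε) (h.maxWeight ε hε) (h.steady ε hε) h.saturated
        (h.arrival_mean ε hε) (h.integrable_queue hε) hc hc', Finset.mul_sum]
      exact Finset.sum_congr rfl fun i _ => by ring
  have hself : ∀ i, W i i = 0 := fun i =>
    tendsto_nhds_unique (hWlim i i) ((h.tendsto_crossMean_self i).mono_left hU)
  have hbal : ∀ j, W 0 j + W 3 j - W 1 j - W 2 j = 0 := fun j =>
    tendsto_nhds_unique ((((hWlim 0 j).add (hWlim 3 j)).sub (hWlim 1 j)).sub (hWlim 2 j))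
      ((h.tendsto_imbalance_idle j).mono_left hU)
  have hVbal : V 0 + V 3 - V 1 - V 2 = 0 :=
    tendsto_nhds_unique ((((hVlim 0).add (hVlim 3)).sub (hVlim 1)).sub (hVlim 2))
      (h.tendsto_scaled_imbalance.mono_left hU)
  -- These three forms agree on the balanced cone with the coordinates 0, 1 and 2.
  have n0 : IsNormalized ![3 / 4, 1 / 4, 1 / 4, -1 / 4] := by
    unfold IsNormalized; simp; norm_num
  have n1 : IsNormalized ![1 / 4, 3 / 4, -1 / 4, 1 / 4] := by
    unfold IsNormalized; simp; norm_num
  have n2 : IsNormalized ![1 / 4, -1 / 4, 3 / 4, 1 / 4] := by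
    unfold IsNormalized; simp; norm_num
  have b0 := hbal 0
  have b1 := hbal 1
  have b2 := hbal 2
  have b3 := hbal 3
  have s0 := hself 0
  have s1 := hself 1
  have s2 := hself 2
  have s3 := hself 3
  refine ⟨![V 0, V 1, V 2], ![W 0 1, W 0 2, W 1 0, W 1 2, W 1 3, W 2 0, W 2 1, W 2 3],
    ⟨fun i => ?_, fun i => ?_, ?_, ?_, ?_, ?_, ?_, ?_, ?_, ?_, ?_⟩, hVlim 0, hVlim 1, hVlim 2⟩
  · fin_cases i <;> exact hV0 _
  · fin_cases i <;> exact hW0 _ _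
  · have := hid _ _ n0 n0
    simp [Fin.sum_univ_four] at this ⊢
    linarith
  · have := hid _ _ n1 n1
    simp [Fin.sum_univ_four] at this ⊢
    linarith
  · have := hid _ _ n2 n2
    simp [Fin.sum_univ_four] at this ⊢
    linarith
  · have := hid _ _ n0 n1
    simp [Fin.sum_univ_four] at this ⊢
    linarith
  · have := hid _ _ n0 n2
    simp [Fin.sum_univ_four] at this ⊢
    linarith
  · have := hid _ _ n1 n2
    simp [Fin.sum_univ_four] at this ⊢
    linarith
  -- The last three constraints are nonnegativity of `V 3`, `W 3 1` and `W 3 2`, eliminated by the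
  -- balance relations and `W i i = 0`.
  · have := hV0 3
    simp
    linarith
  · have := hW0 3 1
    simp
    linarith
  · have := hW0 3 2
    simp
    linarith

theorem integrable_lin {p : PMF QVec}
    (hq : ∀ i, Integrable (fun q : QVec => (q i : ℝ)) p.toMeasure) (α : Fin 3 → ℝ) :
    Integrable (lin α) p.toMeasure :=
  (((hq 0).const_mul _).add ((hq 1).const_mul _)).add ((hq 2).const_mul _)

theorem scaledMean_eq {p : PMF QVec} {ε : ℝ}
    (hq : ∀ i, Integrable (fun q : QVec => (q i : ℝ)) p.toMeasure) (α : Fin 3 → ℝ) :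
    scaledMean p α ε = α 0 * (ε * queueMean p 0) + α 1 * (ε * queueMean p 1)
      + α 2 * (ε * queueMean p 2) := by
  have h01 : Integrable (fun q : QVec => α 0 * (q 0 : ℝ) + α 1 * (q 1 : ℝ)) p.toMeasure :=
    ((hq 0).const_mul _).add ((hq 1).const_mul _)
  unfold scaledMean lin queueMean
  rw [integral_add h01 ((hq 2).const_mul _),
    integral_add ((hq 0).const_mul _) ((hq 1).const_mul _)]
  simp only [integral_const_mul]
  ring

theorem IsHeavyTrafficFamily.exists_mem_values (h : IsHeavyTrafficFamily ν Amax A rule π)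
    {σ : Fin 4 → ℝ}
    (hσ : ∀ i, Tendsto (fun ε => arrivalVar (A ε i)) (𝓝[>] 0) (𝓝 (σ i ^ 2)))
    (α : Fin 3 → ℝ) (U : Ultrafilter ℝ) (hU : (U : Filter ℝ) ≤ 𝓝[>] 0) :
    ∃ x ∈ values σ α, Tendsto (fun ε => scaledMean (π ε) α ε) U (𝓝 x) := by
  obtain ⟨v, w, hvw, l0, l1, l2⟩ := h.exists_mem_polytope hσ U hU
  refine ⟨_, ⟨v, w, hvw, rfl⟩, ?_⟩
  refine (((l0.const_mul (α 0)).add (l1.const_mul (α 1))).add (l2.const_mul (α 2))).congr' ?_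
  filter_upwards [hU eventually_mem_Ioo] with ε hε
  rw [scaledMean_eq (h.integrable_queue hε)]

/-- Feasibility needs no explicit point: a cluster point of the switches themselves is feasible. -/
theorem IsHeavyTrafficFamily.values_nonempty (h : IsHeavyTrafficFamily ν Amax A rule π)
    {σ : Fin 4 → ℝ}
    (hσ : ∀ i, Tendsto (fun ε => arrivalVar (A ε i)) (𝓝[>] 0) (𝓝 (σ i ^ 2)))
    (α : Fin 3 → ℝ) : (values σ α).Nonempty := by
  obtain ⟨x, hx, -⟩ := h.exists_mem_values hσ α (Ultrafilter.of (𝓝[>] 0)) (Ultrafilter.of_le _)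
  exact ⟨x, hx⟩

/-- Otherwise some ultrafilter tending to 0⁺ lives where the scaled mean avoids `S`, while its limit
along that ultrafilter lies in the open set `S`. -/
theorem IsHeavyTrafficFamily.eventually_of_values (h : IsHeavyTrafficFamily ν Amax A rule π)
    {σ : Fin 4 → ℝ}
    (hσ : ∀ i, Tendsto (fun ε => arrivalVar (A ε i)) (𝓝[>] 0) (𝓝 (σ i ^ 2)))
    (α : Fin 3 → ℝ) {S : Set ℝ} (hS : IsOpen S) (hvS : values σ α ⊆ S) :
    ∀ᶠ ε in 𝓝[>] 0, scaledMean (π ε) α ε ∈ S := by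
  by_contra hne
  rw [Filter.not_eventually, Filter.frequently_iff_neBot] at hne
  set U := Ultrafilter.of (𝓝[>] (0 : ℝ) ⊓ 𝓟 {ε | scaledMean (π ε) α ε ∉ S})
  have hle : (U : Filter ℝ) ≤ 𝓝[>] 0 ⊓ 𝓟 {ε | scaledMean (π ε) α ε ∉ S} := Ultrafilter.of_le _
  obtain ⟨x, hx, hlim⟩ := h.exists_mem_values hσ α U (hle.trans inf_le_left)
  have h1 := hlim.eventually (hS.mem_nhds (hvS hx))
  have h2 : ∀ᶠ ε in (U : Filter ℝ), scaledMean (π ε) α ε ∉ S :=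
    hle.trans inf_le_right (mem_principal_self _)
  obtain ⟨ε, h3, h4⟩ := (h1.and h2).exists
  exact h4 h3

/-! ### Tail bound for limits in distribution -/

/-- A point of the cone, where the form is nonnegative, lies within |imbalance| of `q`, and |t| ≤ 1
+ t² brings in the moment already controlled. -/
theorem NonnegOnCone.neg_le_lin {α : Fin 3 → ℝ} (hα : NonnegOnCone α) (q : QVec) :
    -((|α 0| + |α 1| + |α 2|) * (1 + imbalance q ^ 2)) ≤ lin α q := by
  obtain ⟨x, hx, hle⟩ := exists_balancedCone_near (fun i => (q i : ℝ)) fun i => (q i).cast_nonneg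
  have h0 := hα x hx.1 hx.2
  have hd : ∀ i, |(q i : ℝ) - x i| ≤ 1 + imbalance q ^ 2 := by
    intro i
    have h1 : ((q i : ℝ) - x i) ^ 2 ≤ imbalance q ^ 2 :=
      (Finset.single_le_sum (f := fun i => ((q i : ℝ) - x i) ^ 2) (fun i _ => sq_nonneg _)
        (Finset.mem_univ i)).trans hle
    rw [← sq_abs] at h1
    nlinarith [sq_nonneg (|(q i : ℝ) - x i| - 1), abs_nonneg ((q i : ℝ) - x i)]
  have ht : ∀ (β : ℝ) (i : Fin 4), -(|β| * (1 + imbalance q ^ 2)) ≤ β * ((q i : ℝ) - x i) := by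
    intro β i
    refine (neg_le_neg ?_).trans (neg_abs_le _)
    rw [abs_mul]
    exact mul_le_mul_of_nonneg_left (hd i) (abs_nonneg _)
  have t0 := ht (α 0) 0
  have t1 := ht (α 1) 1
  have t2 := ht (α 2) 2
  unfold lin
  linarith

/-- The continuous function `x ↦ x / B`, clamped to `[0, 1]`. -/
def clampDiv (B : ℝ) : BoundedContinuousFunction ℝ ℝ :=
  BoundedContinuousFunction.ofNormedAddCommGroup (fun x => max 0 (min (x / B) 1))
    (by fun_prop) 1 (fun x => by
      rw [Real.norm_of_nonneg (le_max_left _ _)]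
      exact max_le zero_le_one (min_le_right _ _))

theorem clampDiv_apply (B x : ℝ) : clampDiv B x = max 0 (min (x / B) 1) := rfl

theorem measure_Ici_le_integral_clampDiv (μ : ProbabilityMeasure ℝ) {B : ℝ} (hB : 0 < B) :
    (μ : Measure ℝ).real (Set.Ici B) ≤ ∫ x, clampDiv B x ∂(μ : Measure ℝ) := by
  rw [← integral_indicator_one measurableSet_Ici]
  refine integral_mono_of_nonneg
    (Eventually.of_forall fun x => Set.indicator_nonneg (fun _ _ => zero_le_one) x)
    ((clampDiv B).integrable _) (Eventually.of_forall fun x => ?_)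
  rw [clampDiv_apply]
  by_cases hx : x ∈ Set.Ici B
  · rw [Set.indicator_of_mem hx, Pi.one_apply]
    have : 1 ≤ x / B := by rw [le_div_iff₀ hB]; simpa using hx
    rw [min_eq_right this]
    exact le_max_right _ _
  · rw [Set.indicator_of_notMem hx]
    exact le_max_left _ _

/-- Adding the bound on the negative part makes the argument nonnegative, so the clamp is at most
the shifted value over `B`; the shift costs order ε in the mean. -/
theorem integral_clampDiv_scaledLaw_le {p : PMF QVec} {ε B C : ℝ} (hε : 0 < ε) (hB : 0 < B)
    {α : Fin 3 → ℝ} (hα : NonnegOnCone α)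
    (hq : ∀ i, Integrable (fun q : QVec => (q i : ℝ)) p.toMeasure)
    (hd : Integrable (fun q => imbalance q ^ 2) p.toMeasure)
    (hC : ∫ q, imbalance q ^ 2 ∂p.toMeasure ≤ C) :
    ∫ x, clampDiv B x ∂(scaledLaw p α ε : Measure ℝ)
      ≤ (scaledMean p α ε + ε * ((|α 0| + |α 1| + |α 2|) * (1 + C))) / B := by
  set k := |α 0| + |α 1| + |α 2| with hk
  have hk0 : 0 ≤ k := by positivity
  have hm : Measurable fun q : QVec => ε * lin α q := Measurable.of_discrete
  have e : ∫ x, clampDiv B x ∂(scaledLaw p α ε : Measure ℝ)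
      = ∫ q, clampDiv B (ε * lin α q) ∂p.toMeasure :=
    integral_map hm.aemeasurable (clampDiv B).continuous.aestronglyMeasurable
  have hl := integrable_lin hq α
  have h1d : Integrable (fun q => 1 + imbalance q ^ 2) p.toMeasure := (integrable_const _).add hd
  have hr : Integrable (fun q => ε * lin α q + ε * k * (1 + imbalance q ^ 2)) p.toMeasure :=
    (hl.const_mul _).add (h1d.const_mul _)
  have hle : ∫ q, clampDiv B (ε * lin α q) ∂p.toMeasure
      ≤ ∫ q, (ε * lin α q + ε * k * (1 + imbalance q ^ 2)) / B ∂p.toMeasure := by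
    refine integral_mono_of_nonneg (Eventually.of_forall fun q => le_max_left _ _)
      (hr.div_const B) (Eventually.of_forall fun q => ?_)
    simp only
    rw [clampDiv_apply]
    have h1 := mul_le_mul_of_nonneg_left (hα.neg_le_lin q) hε.le
    have h2 : 0 ≤ ε * k * (1 + imbalance q ^ 2) := by positivity
    refine max_le (div_nonneg (by linarith) hB.le) ((min_le_left _ _).trans ?_)
    exact div_le_div_of_nonneg_right (by linarith) hB.le
  rw [e]
  refine hle.trans ?_
  rw [integral_div, integral_add (hl.const_mul _) (h1d.const_mul _), integral_const_mul,
    integral_const_mul, integral_add (integrable_const _) hd]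
  refine div_le_div_of_nonneg_right ?_ hB.le
  have : ε * k * (1 + ∫ q, imbalance q ^ 2 ∂p.toMeasure) ≤ ε * k * (1 + C) :=
    mul_le_mul_of_nonneg_left (by linarith) (by positivity)
  simp [scaledMean]
  linarith

/-- Markov's inequality is applied before the limit, to a bounded continuous majorant of the
indicator of [B, ∞). Weak convergence passes to its integral, and no uniform integrability is
needed. -/
theorem IsHeavyTrafficFamily.measure_Ici_le (h : IsHeavyTrafficFamily ν Amax A rule π)
    {α : Fin 3 → ℝ} (hα : NonnegOnCone α) {b : ℝ}
    (hb : ∀ᶠ ε in 𝓝[>] 0, scaledMean (π ε) α ε < b) {l : Filter ℝ} [l.NeBot]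
    (hl : l ≤ 𝓝[>] 0) {μ : ProbabilityMeasure ℝ}
    (hμ : Tendsto (fun ε => scaledLaw (π ε) α ε) l (𝓝 μ)) {B : ℝ} (hB : 0 < B) :
    (μ : Measure ℝ).real (Set.Ici B) ≤ b / B := by
  refine (measure_Ici_le_integral_clampDiv μ hB).trans ?_
  obtain ⟨C, hC⟩ := h.exists_imbalance_sq_le
  have h1 := ProbabilityMeasure.tendsto_iff_forall_integral_tendsto.1 hμ (clampDiv B)
  have h2 : Tendsto (fun ε => (b + ε * ((|α 0| + |α 1| + |α 2|) * (1 + C))) / B) l (𝓝 (b / B)) := by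
    have := ((tendsto_id_nhdsGT.mono_left hl).mul_const
      ((|α 0| + |α 1| + |α 2|) * (1 + C))).const_add b
    rw [zero_mul, add_zero] at this
    exact this.div_const B
  refine le_of_tendsto_of_tendsto h1 h2 ?_
  filter_upwards [hl eventually_mem_Ioo, hl hC, hl hb] with ε hε hCε hbε
  refine (integral_clampDiv_scaledLaw_le hε.1 hB hα (h.integrable_queue hε) hCε.1 hCε.2).trans ?_
  exact div_le_div_of_nonneg_right (by linarith) hB.le

end Family

end InputQueuedSwitch

end

/-! ### Assembly of the theorem -/

open InputQueuedSwitch in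
theorem theorem3 (ν : Fin 4 → ℝ) (Amax : ℕ) (A : ℝ → Fin 4 → PMF ℕ)
    (rule : ℝ → QVec → PMF QVec) (π : ℝ → PMF QVec)
    (hfam : IsHeavyTrafficFamily ν Amax A rule π)
    (σ : Fin 4 → ℝ)
    (hσ : ∀ i, Tendsto (fun ε => arrivalVar (A ε i)) (𝓝[>] 0) (𝓝 (σ i ^ 2)))
    (α : Fin 3 → ℝ) :
    -- the minimum and the maximum of the linear program are attained
    IsLeast (values σ α) (fLower σ α) ∧
    IsGreatest (values σ α) (fUpper σ α) ∧
    -- the steady-state queue lengths have finite means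
    (∀ ε ∈ Set.Ioo (0 : ℝ) 1, ∀ i,
      Integrable (fun q : QVec => (q i : ℝ)) (π ε).toMeasure) ∧
    -- bounds on the heavy-traffic limit, without assuming that it exists
    (fLower σ α : EReal) ≤ liminf (fun ε => (scaledMean (π ε) α ε : EReal)) (𝓝[>] 0) ∧
    limsup (fun ε => (scaledMean (π ε) α ε : EReal)) (𝓝[>] 0) ≤ (fUpper σ α : EReal) ∧
    -- in particular, bounds on the heavy-traffic limit
    (∀ m : ℝ, Tendsto (fun ε => scaledMean (π ε) α ε) (𝓝[>] 0) (𝓝 m) →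
      fLower σ α ≤ m ∧ m ≤ fUpper σ α) ∧
    -- tail bound for limits in distribution, along the whole family or along a sequence
    (NonnegOnCone α → ∀ l : Filter ℝ, l.NeBot → l ≤ 𝓝[>] 0 → ∀ μ : ProbabilityMeasure ℝ,
      Tendsto (fun ε => scaledLaw (π ε) α ε) l (𝓝 μ) →
      ∀ B : ℝ, 0 < B → (μ : Measure ℝ).real (Set.Ici B) ≤ fUpper σ α / B) := by
  have hne := hfam.values_nonempty hσ α
  have hcpt := isCompact_values σ α
  have hleast : IsLeast (values σ α) (fLower σ α) := hcpt.isLeast_sInf hne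
  have hgreat : IsGreatest (values σ α) (fUpper σ α) := hcpt.isGreatest_sSup hne
  -- An open ray that starts strictly outside the optimal value contains all of `values σ α`, hence
  -- eventually the scaled mean.
  have hlow : ∀ b < fLower σ α, ∀ᶠ ε in 𝓝[>] 0, b < scaledMean (π ε) α ε := fun b hb =>
    hfam.eventually_of_values hσ α isOpen_Ioi fun x hx => hb.trans_le (hleast.2 hx)
  have hup : ∀ b, fUpper σ α < b → ∀ᶠ ε in 𝓝[>] 0, scaledMean (π ε) α ε < b := fun b hb =>
    hfam.eventually_of_values hσ α isOpen_Iio fun x hx => (hgreat.2 hx).trans_lt hb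
  refine ⟨hleast, hgreat, fun ε hε i => hfam.integrable_queue hε i, ?_, ?_, fun m hm => ⟨?_, ?_⟩,
    fun hα l hl hle μ hμ B hB => ?_⟩
  · by_contra hlt
    obtain ⟨c, hc1, hc2⟩ := EReal.lt_iff_exists_real_btwn.1 (not_le.1 hlt)
    refine hc1.not_ge (le_liminf_of_le (by isBoundedDefault) ?_)
    filter_upwards [hlow c (by exact_mod_cast hc2)] with ε hε
    exact_mod_cast hε.le
  · by_contra hlt
    obtain ⟨c, hc1, hc2⟩ := EReal.lt_iff_exists_real_btwn.1 (not_le.1 hlt)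
    refine hc2.not_ge (limsup_le_of_le (by isBoundedDefault) ?_)
    filter_upwards [hup c (by exact_mod_cast hc1)] with ε hε
    exact_mod_cast hε.le
  · refine le_of_forall_lt_imp_le_of_dense fun b hb => ge_of_tendsto hm ?_
    filter_upwards [hlow b hb] with ε hε using hε.le
  · refine le_of_forall_gt_imp_ge_of_dense fun b hb => le_of_tendsto hm ?_
    filter_upwards [hup b hb] with ε hε using hε.le
  · rw [le_div_iff₀ hB]
    refine le_of_forall_gt_imp_ge_of_dense fun b hb => ?_
    rw [← le_div_iff₀ hB]
    exact hfam.measure_Ici_le hα (hup b hb) hle hμ hB
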